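/- Let $\Omega\subset\mathbb{R}^n$ ($n\ge 1$) be a bounded convex open set, $P\in\partial\Omega$ a fixed point, $0<\alpha<1$. All function spaces consist of complex valued functions, $(f,g)=\int_\Omega f\bar g\,dQ$ and $\|\cdot\|$ are the inner product and the norm of $L_2(\Omega)$, $D_i$ are generalized derivatives, and $H_0^1(\Omega)$ carries the norm $\|f\|_{H_0^1}=\big(\sum_{i=1}^n\int_\Omega|D_if|^2\,dQ\big)^{1/2}$. For $Q\in\Omega$ write $r=|Q-P|$, $\vec{\mathbf e}=(Q-P)/r$, and let $\mathfrak D^\alpha$ be Kipriyanov's fractional differential operator $$(\mathfrak D^\alpha f)(Q)=\frac{\alpha}{\Gamma(1-\alpha)}\int_0^r\frac{f(Q)-f(P+\vec{\mathbf e}t)}{(r-t)^{\alpha+1}}\Big(\frac tr\Big)^{n-1}dt+\frac{(n-1)!}{\Gamma(n-\alpha)}\,f(Q)\,r^{-\alpha}.$$ Consider the operator $$Lf=-\sum_{i,j=1}^nD_j\big(a^{ij}D_if\big)+\rho\,\mathfrak D^\alpha f,\qquad \mathrm D(L)=H^2(\Omega)\cap H_0^1(\Omega),$$ with real coefficients such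 that: $a^{ij}\in C^1(\bar\Omega)$ and $\sum_{i,j}a^{ij}(Q)\xi_i\xi_j\ge a|\xi|^2$ for all $Q\in\Omega$, $\xi\in\mathbb R^n$, with a constant $a>0$; $\rho$ satisfies on $\bar\Omega$ a Hölder condition of an order $\mu$, $\alpha<\mu\le1$; and $0<\varrho<\rho(Q)<\mathcal P$ for $Q\in\Omega$, with constants $\varrho,\mathcal P$. Put $\mathcal A=\sup_{Q\in\Omega}\big(\sum_{i,j}|a^{ij}(Q)|^2\big)^{1/2}$. Suppose further that $\eta\ne0$ is a real number with $$\mathrm{Re}\,(f,\rho\,\mathfrak D^\alpha f)\ge\eta^{-2}\|f\|^2,\qquad f\in H_0^1(\Omega).$$ Then $L$ maps $\mathrm D(L)$ into $L_2(\Omega)$; there is a constant $\mathcal K>0$ such that $\mathfrak D^\alpha f\in L_2(\Omega)$ and $\|\mathfrak D^\alpha f\|\le\mathcal K\|f\|_{H_0^1}$ for all $f\in H_0^1(\Omega)$; and for every such $\mathcal K>0$, with $\mathcal I=\mathcal P\mathcal K$ and $$\gamma(\varepsilon)=\eta^{-2}-a\,\frac{\mathcal I}{2}\Big(\frac{\mathcal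 I}{2}\varepsilon^2+\mathcal A\varepsilon\Big)^{-1},\qquad \theta(\varepsilon)=\arctan\Big(\frac{\mathcal I}{2a}\varepsilon+\frac{\mathcal A}{a}\Big),\qquad \xi=\sqrt{\Big(\frac{\mathcal A}{\mathcal I}\Big)^2+a\eta^2}-\frac{\mathcal A}{\mathcal I},$$ the following holds. 1. For every $\varepsilon\in(0,\infty)$ the numerical range $\Theta(L)=\{(Lf,f):\ f\in\mathrm D(L),\ \|f\|=1\}$ is contained in the closed sector $\mathfrak L_{\gamma}(\theta)=\{\zeta\in\mathbb C:\ |\arg(\zeta-\gamma)|\le\theta\}$ with the vertex $\gamma=\gamma(\varepsilon)$ and the semi-angle $\theta=\theta(\varepsilon)<\pi/2$ (the vertex belongs to the sector). 2. $\xi>0$, $\gamma(\varepsilon)<0$ for $\varepsilon\in(0,\xi)$, and $\gamma(\varepsilon)\ge0$ for $\varepsilon\in[\xi,\infty)$. 3. $\gamma(\xi)=0$, and whenever $\varepsilon>0$ and $\gamma(\varepsilon)=0$, the semi-angle is $$\theta(\varepsilon)=\arctan\left\{\sqrt{\Big(\frac{\mathcal A}{2a}\Big)^2+\frac{\mathcal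 I^2\eta^2}{4a}}+\frac{\mathcal A}{2a}\right\}.$$ -/

import Mathlib

open MeasureTheory Filter Topology
open scoped ContDiff NNReal

namespace FracElliptic

noncomputable section

/-- `n`-dimensional Euclidean space. -/
abbrev E (n : ℕ) : Type := EuclideanSpace ℝ (Fin n)

/-! ### Function spaces on an open set -/

/-- The `i`-th classical partial derivative. -/
def partialDeriv {n : ℕ} (i : Fin n) (φ : E n → ℂ) (Q : E n) : ℂ :=
  fderiv ℝ φ Q (EuclideanSpace.single i 1)

/-- The class `C_0^∞(Ω)`: complex valued smooth functions with compact support in `Ω`. -/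
def IsTestFunction {n : ℕ} (Ω : Set (E n)) (φ : E n → ℂ) : Prop :=
  ContDiff ℝ ∞ φ ∧ HasCompactSupport φ ∧ tsupport φ ⊆ Ω

/-- `g` is a generalized (weak) derivative of `f` in `Ω` in the `i`-th coordinate variable. -/
def HasWeakPartial {n : ℕ} (Ω : Set (E n)) (i : Fin n) (f g : E n → ℂ) : Prop :=
  LocallyIntegrableOn f Ω ∧ LocallyIntegrableOn g Ω ∧
    ∀ φ : E n → ℂ, IsTestFunction Ω φ →
      ∫ Q in Ω, f Q * partialDeriv i φ Q = -∫ Q in Ω, g Q * φ Q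

open Classical in
/-- The generalized derivative `D_i f` (determined almost everywhere in `Ω`; it is set to be `0`
if there is none). -/
def weakPartial {n : ℕ} (Ω : Set (E n)) (i : Fin n) (f : E n → ℂ) : E n → ℂ :=
  if h : ∃ g, HasWeakPartial Ω i f g then h.choose else 0

/-- `f ∈ L_2(Ω)`. -/
def MemL2 {n : ℕ} (Ω : Set (E n)) (f : E n → ℂ) : Prop :=
  MemLp f 2 (volume.restrict Ω)

/-- `f ∈ H^l(Ω) = W_2^l(Ω)`: all generalized derivatives up to the order `l` are in `L_2(Ω)`. -/
def MemSobolev {n : ℕ} (Ω : Set (E n)) : ℕ → (E n → ℂ) → Prop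
  | 0, f => MemL2 Ω f
  | l + 1, f => MemL2 Ω f ∧ ∀ i : Fin n, ∃ g, HasWeakPartial Ω i f g ∧ MemSobolev Ω l g

/-- `f ∈ H_0^1(Ω)`: `f` is in the closure of `C_0^∞(Ω)` in `H^1(Ω)`. -/
def MemH10 {n : ℕ} (Ω : Set (E n)) (f : E n → ℂ) : Prop :=
  MemSobolev Ω 1 f ∧ ∃ φ : ℕ → E n → ℂ, (∀ k, IsTestFunction Ω (φ k)) ∧
    Tendsto (fun k => eLpNorm (f - φ k) 2 (volume.restrict Ω)) atTop (𝓝 0) ∧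
    ∀ i : Fin n, Tendsto
      (fun k => eLpNorm (weakPartial Ω i f - partialDeriv i (φ k)) 2 (volume.restrict Ω))
      atTop (𝓝 0)

/-- The inner product `(f, g)` of `L_2(Ω)`, linear in the first argument. -/
def innerL2 {n : ℕ} (Ω : Set (E n)) (f g : E n → ℂ) : ℂ :=
  ∫ Q in Ω, f Q * (starRingEnd ℂ) (g Q)

/-- The norm of `L_2(Ω)`. -/
def normL2 {n : ℕ} (Ω : Set (E n)) (f : E n → ℂ) : ℝ :=
  Real.sqrt (∫ Q in Ω, ‖f Q‖ ^ 2)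

/-- The norm of `H_0^1(Ω)`. -/
def normH10 {n : ℕ} (Ω : Set (E n)) (f : E n → ℂ) : ℝ :=
  Real.sqrt (∑ i : Fin n, ∫ Q in Ω, ‖weakPartial Ω i f Q‖ ^ 2)

/-- `g ∈ C^1(closure Ω)`: `g` is continuous on the closure, continuously differentiable in `Ω`,
and its derivative extends continuously to the closure. -/
def IsC1Closure {n : ℕ} (Ω : Set (E n)) (g : E n → ℝ) : Prop :=
  ContinuousOn g (closure Ω) ∧ ContDiffOn ℝ 1 g Ω ∧
    ∃ G : E n → (E n →L[ℝ] ℝ), ContinuousOn G (closure Ω) ∧ Set.EqOn (fderiv ℝ g) G Ω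

/-! ### The operators -/

/-- Kipriyanov's fractional differential operator of order `α`, taken along the rays that issue
from `P`; here `r = |Q - P|` and `e = (Q - P) / r`. -/
def kipriyanov {n : ℕ} (P : E n) (α : ℝ) (f : E n → ℂ) (Q : E n) : ℂ :=
  let r : ℝ := ‖Q - P‖
  let e : E n := r⁻¹ • (Q - P)
  ((α / Real.Gamma (1 - α) : ℝ) : ℂ) *
      (∫ t in (0 : ℝ)..r, (((t / r) ^ (n - 1) / (r - t) ^ (α + 1) : ℝ) : ℂ) *
        (f Q - f (P + t • e)))
    + ((((n - 1).factorial : ℝ) / Real.Gamma (n - α) * r ^ (-α) : ℝ) : ℂ) * f Q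

/-- The domain `D(L) = H^2(Ω) ∩ H_0^1(Ω)`. -/
def domL {n : ℕ} (Ω : Set (E n)) : Set (E n → ℂ) :=
  {f | MemSobolev Ω 2 f ∧ MemH10 Ω f}

/-- The operator `L f = - D_j (a^{ij} D_i f) + ρ 𝔇^α f`. -/
def opL {n : ℕ} (Ω : Set (E n)) (P : E n) (α : ℝ) (A : Fin n → Fin n → E n → ℝ) (ρ : E n → ℝ)
    (f : E n → ℂ) (Q : E n) : ℂ :=
  -(∑ j : Fin n, weakPartial Ω j (fun x => ∑ i : Fin n, (A i j x : ℂ) * weakPartial Ω i f x) Q)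
    + (ρ Q : ℂ) * kipriyanov P α f Q

/-- The numerical range in `L_2(Ω)` of an operator `T` with the domain `D`. -/
def numericalRange {n : ℕ} (Ω : Set (E n)) (D : Set (E n → ℂ)) (T : (E n → ℂ) → E n → ℂ) :
    Set ℂ :=
  {z | ∃ f ∈ D, normL2 Ω f = 1 ∧ z = innerL2 Ω (T f) f}

/-- The closed sector with the vertex `γ` and the semi-angle `θ < π / 2`. -/
def sector (γ : ℂ) (θ : ℝ) : Set ℂ :=
  {ζ | |Complex.arg (ζ - γ)| ≤ θ ∧ θ < Real.pi / 2}

/-! ### The constants -/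

/-- `𝒜`, the supremum over `Ω` of the Euclidean norm of the coefficient matrix. -/
def coeffSup {n : ℕ} (Ω : Set (E n)) (A : Fin n → Fin n → E n → ℝ) : ℝ :=
  sSup ((fun Q => Real.sqrt (∑ i : Fin n, ∑ j : Fin n, |A i j Q| ^ 2)) '' Ω)

/-- The vertex `γ` as a function of `ε`. -/
def vertex (a 𝒜 ℐ η ε : ℝ) : ℝ :=
  (η ^ 2)⁻¹ - a * (ℐ / 2) * (ℐ / 2 * ε ^ 2 + 𝒜 * ε)⁻¹

/-- The semi-angle `θ` as a function of `ε`. -/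
def semiAngle (a 𝒜 ℐ ε : ℝ) : ℝ :=
  Real.arctan (ℐ / (2 * a) * ε + 𝒜 / a)

/-- The critical value `ξ` of the parameter `ε`. -/
def xi (a 𝒜 ℐ η : ℝ) : ℝ :=
  Real.sqrt ((𝒜 / ℐ) ^ 2 + a * η ^ 2) - 𝒜 / ℐ

/-- `K` is a constant of the estimate `‖𝔇^α f‖ ≤ K ‖f‖`, where `𝔇^α` acts from `H_0^1(Ω)` to
`L_2(Ω)`. -/
def IsKipriyanovBound {n : ℕ} (Ω : Set (E n)) (P : E n) (α K : ℝ) : Prop :=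
  ∀ f : E n → ℂ, MemH10 Ω f →
    MemL2 Ω (kipriyanov P α f) ∧ normL2 Ω (kipriyanov P α f) ≤ K * normH10 Ω f

end

end FracElliptic

namespace FracElliptic


/-! ### Inequalities for lower integrals -/

/-! For `f` in the domain with `‖f‖ = 1`, put `N = ‖f‖_{H_0^1}`. Integration by parts turns `(Lf,
f)` into `∫ ∑ a^{ij} D_i f conj(D_j f)` plus `(ρ 𝔇^α f, f)`. Ellipticity and accretivity give `Re ≥
a N² + η⁻²`; Cauchy–Schwarz for the coefficient matrix and the bound `𝒦` give `|Im| ≤ 𝒜 N² + ℐ N`.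
Young's inequality `ℐ N ≤ (ℐ/2) ε N² + ℐ/(2ε)` makes the second bound at most `tan θ(ε)` times `Re -
γ(ε)`, which is membership in the sector (`mem_sector`). The sign of the vertex follows from a
factorization of `γ` with the simple root `ξ` (`vertex_eq`).

The analytic work is the existence of `𝒦`. Substituting `t = ru` writes `𝔇^α f` as an integral over
`u ∈ (0,1)` of weighted increments `r^{-α}(f(Q) - f(P + u(Q-P)))`, plus a multiple of `r^{-α} f`.
For smooth `f` the fundamental theorem of calculus along rays and a change of variables bound the
`L_2` norm of the increment by a constant times `(1-u) u^{-n/2} ‖∇f‖`; against the kernel this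
leaves the convergent Beta integral with parameters `n/2` and `1-α`. The term `r^{-α} f` is
controlled by Hardy's inequality (`IsTestFunction.hardy`), itself obtained from a single increment,
that of ratio `1/2`. Almost everywhere convergence of a subsequence and Fatou's lemma carry the
estimates from test functions to `H_0^1`.

The remaining difficulty is that the derivatives in `L` are weak ones, picked by choice. Uniqueness
of weak derivatives and a product rule with `C^1` coefficients (`exists_hasWeakPartial_flux`) show
that the flux has a weak divergence in `L_2`, so that the integration by parts is legitimate. -/

lemma lintegral_mul_sq_le {X : Type*} [MeasurableSpace X] (μ : Measure X) {f g : X → ENNReal}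
    (hf : AEMeasurable f μ) (hg : AEMeasurable g μ) :
    (∫⁻ x, f x * g x ∂μ) ^ 2 ≤ (∫⁻ x, f x ^ 2 ∂μ) * ∫⁻ x, g x ^ 2 ∂μ := by
  have h := ENNReal.lintegral_mul_le_Lp_mul_Lq μ (p := 2) (q := 2)
    (Real.holderConjugate_iff.mpr ⟨by norm_num, by norm_num⟩) hf hg
  have key : ∀ a : ENNReal, (a ^ (1 / 2 : ℝ)) ^ 2 = a := fun a => by
    rw [← ENNReal.rpow_natCast, ← ENNReal.rpow_mul]; norm_num
  calc (∫⁻ x, f x * g x ∂μ) ^ 2 ≤ _ := pow_le_pow_left' h 2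
    _ = _ := by
      rw [mul_pow, key, key]
      simp only [← ENNReal.rpow_natCast, Nat.cast_ofNat]

lemma lintegral_sq_le {X : Type*} [MeasurableSpace X] (μ : Measure X) {f : X → ENNReal}
    (hf : AEMeasurable f μ) :
    (∫⁻ x, f x ∂μ) ^ 2 ≤ μ Set.univ * ∫⁻ x, f x ^ 2 ∂μ := by
  simpa using lintegral_mul_sq_le μ (f := fun _ => 1) aemeasurable_const hf

lemma enn_add_sq_le (a b : ENNReal) : (a + b) ^ 2 ≤ 2 * (a ^ 2 + b ^ 2) := by
  have := ENNReal.rpow_add_le_mul_rpow_add_rpow a b (p := 2) (by norm_num)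
  norm_num at this
  simpa only [← ENNReal.rpow_natCast, Nat.cast_ofNat] using this

lemma eLpNorm_two_sq {X F : Type*} [MeasurableSpace X] [NormedAddCommGroup F] (μ : Measure X)
    (f : X → F) : eLpNorm f 2 μ ^ 2 = ∫⁻ x, ‖f x‖ₑ ^ 2 ∂μ := by
  have := eLpNorm_nnreal_pow_eq_lintegral (μ := μ) (f := f) (p := 2) (by norm_num)
  simpa only [ENNReal.coe_ofNat, NNReal.coe_ofNat, ENNReal.rpow_ofNat] using this

/-! ### Homotheties -/

section homothety

variable {n : ℕ}

lemma lintegral_homothety (P : E n) {u : ℝ} (hu : 0 < u) (g : E n → ENNReal) :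
    ∫⁻ Q, g (P + u • (Q - P)) = ENNReal.ofReal (u ^ n)⁻¹ * ∫⁻ Q, g Q := by
  have h1 : ∫⁻ Q, g (P + u • (Q - P)) = ∫⁻ Q, g (P + u • Q) :=
    lintegral_sub_right_eq_self (fun Q => g (P + u • Q)) P
  have h2 : ∫⁻ Q : E n, g (P + u • Q) = ∫⁻ Q, g (P + Q) ∂(Measure.map (u • ·) volume) :=
    ((Homeomorph.smulOfNeZero u hu.ne').measurableEmbedding.lintegral_map
      (fun Q => g (P + Q))).symm
  rw [h1, h2, Measure.map_addHaar_smul _ hu.ne', lintegral_smul_measure,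
    lintegral_add_left_eq_self (fun Q => g Q) P]
  simp [abs_of_pos hu]

lemma volume_preimage_homothety_null (P : E n) {u : ℝ} (hu : 0 < u) {s : Set (E n)}
    (hs : volume s = 0) : volume ((fun Q => P + u • (Q - P)) ⁻¹' s) = 0 := by
  obtain ⟨t, hst, ht, ht0⟩ := exists_measurable_superset_of_null hs
  refine measure_mono_null (Set.preimage_mono hst) ?_
  have hm : Measurable (fun Q : E n => P + u • (Q - P)) := by fun_prop
  have := lintegral_homothety P hu (t.indicator 1)
  rw [lintegral_indicator_one ht, ht0, mul_zero] at this
  rw [← lintegral_indicator_one (hm ht), ← this]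
  rfl

/-- The only place where convexity of `Ω` enters: every ray segment from the boundary point `P` to a
point of `Ω` stays in `Ω`, apart from its endpoint `P`. -/
lemma homothety_mem {Ω : Set (E n)} (hΩo : IsOpen Ω) (hΩc : Convex ℝ Ω) {P Q : E n}
    (hP : P ∈ closure Ω) (hQ : Q ∈ Ω) {u : ℝ} (hu : 0 < u) (hu1 : u ≤ 1) :
    P + u • (Q - P) ∈ Ω := by
  have := hΩc.combo_closure_interior_mem_interior hP (hΩo.interior_eq.symm ▸ hQ)
    (sub_nonneg.2 hu1) hu (by ring)
  rw [hΩo.interior_eq] at this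
  convert this using 1
  module

/-- The restriction of the homothety of ratio `u` to `Ω`. -/
lemma quasiMeasurePreserving_homothety {Ω : Set (E n)} (hΩo : IsOpen Ω) (hΩc : Convex ℝ Ω)
    {P : E n} (hP : P ∈ closure Ω) {u : ℝ} (hu : 0 < u) (hu1 : u ≤ 1) :
    Measure.QuasiMeasurePreserving (fun Q => P + u • (Q - P)) (volume.restrict Ω)
      (volume.restrict Ω) := by
  have hm : Measurable (fun Q : E n => P + u • (Q - P)) := by fun_prop
  refine ⟨hm, Measure.AbsolutelyContinuous.mk fun s hs h0 => ?_⟩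
  rw [Measure.restrict_apply hs] at h0
  rw [Measure.map_apply hm hs, Measure.restrict_apply (hm hs)]
  refine measure_mono_null ?_ (volume_preimage_homothety_null P hu h0)
  exact fun Q hQ => ⟨hQ.1, homothety_mem hΩo hΩc hP hQ.2 hu hu1⟩

/-- The family of homotheties with ratio in `(0, 1)`, as a map of two variables. -/
lemma quasiMeasurePreserving_homothety_prod {Ω : Set (E n)} (hΩo : IsOpen Ω)
    (hΩc : Convex ℝ Ω) {P : E n} (hP : P ∈ closure Ω) :
    Measure.QuasiMeasurePreserving (fun z : ℝ × E n => P + z.1 • (z.2 - P))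
      ((volume.restrict (Set.Ioo (0 : ℝ) 1)).prod (volume.restrict Ω)) (volume.restrict Ω) := by
  have hm : Measurable (fun z : ℝ × E n => P + z.1 • (z.2 - P)) := by fun_prop
  refine ⟨hm, Measure.AbsolutelyContinuous.mk fun s hs h0 => ?_⟩
  rw [Measure.map_apply hm hs, Measure.measure_prod_null (hm hs)]
  filter_upwards [ae_restrict_mem measurableSet_Ioo] with u hu
  exact (quasiMeasurePreserving_homothety hΩo hΩc hP hu.1 hu.2.le).preimage_null h0

/-! ### Increments along the rays -/

lemma enorm_increment_le {φ : E n → ℂ} (hφ : ContDiff ℝ 1 φ) (P V : E n) {u : ℝ}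
    (hu1 : u ≤ 1) :
    ‖φ (P + V) - φ (P + u • V)‖ₑ ≤ ∫⁻ s in Set.Ioc u 1, ‖fderiv ℝ φ (P + s • V)‖ₑ * ‖V‖ₑ := by
  have hd : ∀ s : ℝ, HasDerivAt (fun s : ℝ => φ (P + s • V)) (fderiv ℝ φ (P + s • V) V) s := by
    intro s
    have h1 : HasDerivAt (fun s : ℝ => P + s • V) V s := by
      simpa using ((hasDerivAt_id s).smul_const V).const_add P
    exact ((hφ.differentiable (by norm_num)) _).hasFDerivAt.comp_hasDerivAt s h1
  have hc : Continuous fun s : ℝ => fderiv ℝ φ (P + s • V) V := by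
    have := hφ.continuous_fderiv (by norm_num)
    fun_prop
  have h := intervalIntegral.integral_eq_sub_of_hasDerivAt (a := u) (b := 1)
    (fun s _ => hd s) (hc.intervalIntegrable _ _)
  rw [one_smul] at h
  rw [← h, intervalIntegral.integral_of_le hu1]
  refine (enorm_integral_le_lintegral_enorm _).trans (lintegral_mono fun s => ?_)
  exact ContinuousLinearMap.le_opENorm _ _

lemma enorm_increment_sq_le {φ : E n → ℂ} (hφ : ContDiff ℝ 1 φ) (P V : E n) {u : ℝ}
    (hu1 : u ≤ 1) :
    ‖φ (P + V) - φ (P + u • V)‖ₑ ^ 2 ≤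
      ENNReal.ofReal (1 - u) * ‖V‖ₑ ^ 2 *
        ∫⁻ s in Set.Ioc u 1, ‖fderiv ℝ φ (P + s • V)‖ₑ ^ 2 := by
  have hc : Continuous fun s : ℝ => fderiv ℝ φ (P + s • V) := by
    have := hφ.continuous_fderiv (by norm_num)
    fun_prop
  calc _ ≤ (∫⁻ s in Set.Ioc u 1, ‖fderiv ℝ φ (P + s • V)‖ₑ * ‖V‖ₑ) ^ 2 :=
        pow_le_pow_left' (enorm_increment_le hφ P V hu1) 2
    _ ≤ _ := lintegral_sq_le _ (hc.enorm.measurable.mul_const _).aemeasurable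
    _ = _ := by
      simp_rw [mul_pow]
      rw [lintegral_mul_const _ (hc.enorm.measurable.pow_const 2)]
      simp only [Measure.restrict_apply_univ, Real.volume_Ioc]
      ring

/-- The weighted increment of a smooth function along the rays that issue from `P`. -/
lemma lintegral_increment_le {φ : E n → ℂ} (hφ : ContDiff ℝ 1 φ) (P : E n) {S : Set (E n)}
    {D β : ℝ} (hS : MeasurableSet S) (hD : ∀ Q ∈ S, ‖Q - P‖ ≤ D) (hβ : β < 1) {u : ℝ}
    (hu : 0 < u) (hu1 : u ≤ 1) :
    ∫⁻ Q in S, ‖‖Q - P‖ ^ (-β) • (φ Q - φ (P + u • (Q - P)))‖ₑ ^ 2 ≤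
      ENNReal.ofReal (D ^ (2 - 2 * β) * (1 - u) ^ 2 * (u ^ n)⁻¹) *
        ∫⁻ Q, ‖fderiv ℝ φ Q‖ₑ ^ 2 := by
  have hc := hφ.continuous_fderiv (by norm_num)
  have hpt : ∀ Q ∈ S, ‖‖Q - P‖ ^ (-β) • (φ Q - φ (P + u • (Q - P)))‖ₑ ^ 2 ≤
      ENNReal.ofReal (D ^ (2 - 2 * β) * (1 - u)) *
        ∫⁻ s in Set.Ioc u 1, ‖fderiv ℝ φ (P + s • (Q - P))‖ₑ ^ 2 := by
    intro Q hQ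
    rw [enorm_smul, mul_pow]
    have h1 := enorm_increment_sq_le hφ P (Q - P) hu1
    rw [add_sub_cancel] at h1
    refine (mul_le_mul_right h1 _).trans ?_
    rw [← mul_assoc]
    refine mul_le_mul_left ?_ _
    rw [Real.enorm_eq_ofReal (by positivity), ← ofReal_norm (Q - P),
      ← ENNReal.ofReal_pow (by positivity), ← ENNReal.ofReal_pow (by positivity),
      ← ENNReal.ofReal_mul (by linarith), ← ENNReal.ofReal_mul (by positivity)]
    refine ENNReal.ofReal_le_ofReal ?_
    have h0 : 0 ≤ ‖Q - P‖ := norm_nonneg _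
    -- Only an inequality is needed, which also covers `Q = P`, where the left side vanishes.
    have h2 : (‖Q - P‖ ^ (-β)) ^ 2 * ‖Q - P‖ ^ 2 ≤ ‖Q - P‖ ^ (2 - 2 * β) := by
      rcases h0.eq_or_lt with h | h
      · rw [← h]; simp; positivity
      · rw [← Real.rpow_natCast, ← Real.rpow_natCast, ← Real.rpow_mul h0, ← Real.rpow_add h]
        refine le_of_eq ?_
        congr 1; push_cast; ring
    have h3 : ‖Q - P‖ ^ (2 - 2 * β) ≤ D ^ (2 - 2 * β) :=
      Real.rpow_le_rpow h0 (hD Q hQ) (by linarith)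
    calc _ = ((‖Q - P‖ ^ (-β)) ^ 2 * ‖Q - P‖ ^ 2) * (1 - u) := by ring
      _ ≤ _ := mul_le_mul_of_nonneg_right (h2.trans h3) (by linarith)
  have hmeas : Measurable fun z : E n × ℝ => ‖fderiv ℝ φ (P + z.2 • (z.1 - P))‖ₑ ^ 2 := by
    have : Continuous fun z : E n × ℝ => fderiv ℝ φ (P + z.2 • (z.1 - P)) := by fun_prop
    exact this.enorm.measurable.pow_const 2
  rcases S.eq_empty_or_nonempty with rfl | ⟨Q₀, hQ₀⟩
  · simp
  have hD0 : 0 ≤ D := (norm_nonneg _).trans (hD Q₀ hQ₀)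
  calc _ ≤ ∫⁻ Q in S, ENNReal.ofReal (D ^ (2 - 2 * β) * (1 - u)) *
        ∫⁻ s in Set.Ioc u 1, ‖fderiv ℝ φ (P + s • (Q - P))‖ₑ ^ 2 := setLIntegral_mono' hS hpt
    -- Enlarging `S` to the whole space makes the substitution by the homothety of ratio `s` exact;
    -- its Jacobian `s^{-n}` is at most `u^{-n}`.
    _ ≤ ∫⁻ Q, ENNReal.ofReal (D ^ (2 - 2 * β) * (1 - u)) *
        ∫⁻ s in Set.Ioc u 1, ‖fderiv ℝ φ (P + s • (Q - P))‖ₑ ^ 2 :=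
      lintegral_mono' Measure.restrict_le_self le_rfl
    _ = ENNReal.ofReal (D ^ (2 - 2 * β) * (1 - u)) *
        ∫⁻ s in Set.Ioc u 1, ∫⁻ Q, ‖fderiv ℝ φ (P + s • (Q - P))‖ₑ ^ 2 := by
      rw [lintegral_const_mul' _ _ ENNReal.ofReal_ne_top,
        lintegral_lintegral_swap hmeas.aemeasurable]
    _ ≤ ENNReal.ofReal (D ^ (2 - 2 * β) * (1 - u)) *
        ∫⁻ s in Set.Ioc u 1, ENNReal.ofReal (u ^ n)⁻¹ * ∫⁻ Q, ‖fderiv ℝ φ Q‖ₑ ^ 2 := by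
      refine mul_le_mul_right (setLIntegral_mono' measurableSet_Ioc fun s hs => ?_) _
      rw [lintegral_homothety P (hu.trans hs.1) (fun Q => ‖fderiv ℝ φ Q‖ₑ ^ 2)]
      refine mul_le_mul_left (ENNReal.ofReal_le_ofReal ?_) _
      have := hs.1.le
      gcongr
    _ = _ := by
      have hD1 := Real.rpow_nonneg hD0 (2 - 2 * β)
      have hD2 := mul_nonneg hD1 (sub_nonneg.2 hu1)
      rw [lintegral_const, Measure.restrict_apply_univ, Real.volume_Ioc,
        mul_comm (_ * _) (ENNReal.ofReal (1 - u)), ← mul_assoc, ← mul_assoc,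
        ← ENNReal.ofReal_mul hD2, ← ENNReal.ofReal_mul (mul_nonneg hD2 (sub_nonneg.2 hu1))]
      congr 2
      ring

end homothety


/-! ### Gradient energy and approximation in `H_0^1` -/

section energy

variable {n : ℕ} {Ω : Set (E n)}

lemma aestronglyMeasurable_weakPartial (i : Fin n) (f : E n → ℂ) :
    AEStronglyMeasurable (weakPartial Ω i f) (volume.restrict Ω) := by
  unfold weakPartial
  split_ifs with h
  · exact h.choose_spec.2.1.aestronglyMeasurable
  · exact aestronglyMeasurable_const

lemma IsTestFunction.continuous_partialDeriv {φ : E n → ℂ} (hφ : IsTestFunction Ω φ)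
    (i : Fin n) : Continuous (partialDeriv i φ) := by
  have := hφ.1.continuous_fderiv (by norm_num)
  unfold partialDeriv
  fun_prop

lemma IsTestFunction.memLp {φ : E n → ℂ} (hφ : IsTestFunction Ω φ) :
    MemLp φ 2 (volume.restrict Ω) :=
  (hφ.1.continuous.memLp_of_hasCompactSupport hφ.2.1).restrict _

lemma IsTestFunction.hasCompactSupport_partialDeriv {φ : E n → ℂ} (hφ : IsTestFunction Ω φ)
    (i : Fin n) : HasCompactSupport (partialDeriv i φ) :=
  hφ.2.1.fderiv_apply ℝ _

lemma IsTestFunction.memLp_partialDeriv {φ : E n → ℂ} (hφ : IsTestFunction Ω φ) (i : Fin n) :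
    MemLp (partialDeriv i φ) 2 (volume.restrict Ω) :=
  ((hφ.continuous_partialDeriv i).memLp_of_hasCompactSupport
    (hφ.hasCompactSupport_partialDeriv i)).restrict _

lemma norm_clm_le_sum (L : E n →L[ℝ] ℂ) : ‖L‖ ≤ ∑ i, ‖L (EuclideanSpace.single i 1)‖ := by
  refine L.opNorm_le_bound (Finset.sum_nonneg fun _ _ => norm_nonneg _) fun v => ?_
  have hv : v = ∑ i, v i • EuclideanSpace.single i (1 : ℝ) := by
    ext j
    simp [Finset.sum_apply, Pi.single_apply]
  conv_lhs => rw [hv]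
  rw [map_sum, Finset.sum_mul]
  refine (norm_sum_le _ _).trans (Finset.sum_le_sum fun i _ => ?_)
  rw [map_smul, norm_smul, mul_comm]
  exact mul_le_mul_of_nonneg_left (PiLp.norm_apply_le v i) (norm_nonneg _)

lemma enorm_clm_sq_le_sum (L : E n →L[ℝ] ℂ) :
    ‖L‖ₑ ^ 2 ≤ n * ∑ i, ‖L (EuclideanSpace.single i 1)‖ₑ ^ 2 := by
  have h : ‖L‖ ^ 2 ≤ n * ∑ i, ‖L (EuclideanSpace.single i 1)‖ ^ 2 := by
    have := sq_sum_le_card_mul_sum_sq (s := (Finset.univ : Finset (Fin n)))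
      (f := fun i => ‖L (EuclideanSpace.single i 1)‖)
    rw [Finset.card_univ, Fintype.card_fin] at this
    exact (pow_le_pow_left₀ (norm_nonneg _) (norm_clm_le_sum L) 2).trans this
  have h2 := ENNReal.ofReal_le_ofReal h
  rw [ENNReal.ofReal_mul (by positivity), ENNReal.ofReal_sum_of_nonneg (fun _ _ => by positivity),
    ENNReal.ofReal_natCast] at h2
  simpa only [ENNReal.ofReal_pow (norm_nonneg _), ofReal_norm] using h2

lemma lintegral_fderiv_le (hΩ : IsOpen Ω) {φ : E n → ℂ} (hφ : IsTestFunction Ω φ) :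
    ∫⁻ Q, ‖fderiv ℝ φ Q‖ₑ ^ 2 ≤ n * ∑ i, eLpNorm (partialDeriv i φ) 2 (volume.restrict Ω) ^ 2 := by
  have h1 : ∫⁻ Q, ‖fderiv ℝ φ Q‖ₑ ^ 2 = ∫⁻ Q in Ω, ‖fderiv ℝ φ Q‖ₑ ^ 2 := by
    rw [← lintegral_indicator hΩ.measurableSet]
    refine lintegral_congr fun Q => ?_
    by_cases hQ : Q ∈ Ω
    · rw [Set.indicator_of_mem hQ]
    · rw [Set.indicator_of_notMem hQ]
      have : fderiv ℝ φ Q = 0 := image_eq_zero_of_notMem_tsupport fun h =>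
        hQ (hφ.2.2 (tsupport_fderiv_subset ℝ h))
      simp [this, ← ofReal_norm]
  rw [h1]
  simp_rw [eLpNorm_two_sq]
  rw [← lintegral_finsetSum' _ fun i _ =>
      ((hφ.continuous_partialDeriv i).enorm.measurable.pow_const 2).aemeasurable,
    ← lintegral_const_mul' _ _ (ENNReal.natCast_ne_top n)]
  exact lintegral_mono fun Q => enorm_clm_sq_le_sum _

/-- Fatou's lemma, in the form that transfers a quadratic estimate from approximating test functions
to their limit without knowing in advance that the limit is square integrable. -/
lemma lintegral_enorm_sq_le_of_tendsto {X : Type*} [MeasurableSpace X] {μ : Measure X}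
    {w : ℕ → X → ℂ} {f : X → ℂ} (hw : ∀ k, AEStronglyMeasurable (w k) μ)
    (h : ∀ᵐ x ∂μ, Tendsto (fun k => w k x) atTop (𝓝 (f x))) {C G : ENNReal} {g : ℕ → ENNReal}
    (hC : C ≠ ⊤) (hg : Tendsto g atTop (𝓝 G)) (hb : ∀ k, ∫⁻ x, ‖w k x‖ₑ ^ 2 ∂μ ≤ C * g k) :
    ∫⁻ x, ‖f x‖ₑ ^ 2 ∂μ ≤ C * G := by
  calc ∫⁻ x, ‖f x‖ₑ ^ 2 ∂μ = ∫⁻ x, liminf (fun k => ‖w k x‖ₑ ^ 2) atTop ∂μ := by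
        refine lintegral_congr_ae ?_
        filter_upwards [h] with x hx
        exact (((ENNReal.continuous_pow 2).tendsto _).comp hx.enorm).liminf_eq.symm
    _ ≤ liminf (fun k => ∫⁻ x, ‖w k x‖ₑ ^ 2 ∂μ) atTop :=
      lintegral_liminf_le' fun k => (hw k).enorm.pow_const 2
    _ ≤ liminf (fun k => C * g k) atTop := liminf_le_liminf (Eventually.of_forall hb)
    _ = C * G := (ENNReal.Tendsto.const_mul hg (Or.inr hC)).liminf_eq

/-- The square of the norm of `H_0^1(Ω)`, as an extended nonnegative number. -/
noncomputable def energy (Ω : Set (E n)) (f : E n → ℂ) : ENNReal :=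
  ∑ i, eLpNorm (weakPartial Ω i f) 2 (volume.restrict Ω) ^ 2

/-- A subsequence of the approximants of the definition. The majorant `g k` comes from the triangle
inequality for the gradients and replaces convergence of their norms. -/
lemma MemH10.exists_approx {f : E n → ℂ} (hf : MemH10 Ω f) :
    ∃ (φ : ℕ → E n → ℂ) (g : ℕ → ENNReal), (∀ k, IsTestFunction Ω (φ k)) ∧
      (∀ᵐ Q ∂(volume.restrict Ω), Tendsto (fun k => φ k Q) atTop (𝓝 (f Q))) ∧
      Tendsto g atTop (𝓝 (energy Ω f)) ∧
      ∀ k, ∑ i, eLpNorm (partialDeriv i (φ k)) 2 (volume.restrict Ω) ^ 2 ≤ g k := by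
  obtain ⟨hf1, φ, hφ, hφ0, hφ1⟩ := hf
  have hf2 : MemL2 Ω f := hf1.1
  have hm : TendstoInMeasure (volume.restrict Ω) φ atTop f := by
    refine tendstoInMeasure_of_tendsto_eLpNorm two_ne_zero
      (fun k => (hφ k).1.continuous.aestronglyMeasurable) hf2.1 ?_
    simpa only [eLpNorm_sub_comm f] using hφ0
  obtain ⟨σ, hσ, hae⟩ := hm.exists_seq_tendsto_ae
  refine ⟨fun k => φ (σ k), fun k => ∑ i, (eLpNorm (weakPartial Ω i f) 2 (volume.restrict Ω) +
    eLpNorm (weakPartial Ω i f - partialDeriv i (φ (σ k))) 2 (volume.restrict Ω)) ^ 2,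
    fun k => hφ _, hae, ?_, fun k => Finset.sum_le_sum fun i _ => ?_⟩
  · refine tendsto_finsetSum _ fun i _ => ((ENNReal.continuous_pow 2).tendsto _).comp ?_
    simpa using (tendsto_const_nhds (x := eLpNorm (weakPartial Ω i f) 2 (volume.restrict Ω))).add
      ((hφ1 i).comp hσ.tendsto_atTop)
  · refine pow_le_pow_left' ?_ 2
    have := eLpNorm_sub_le (p := 2) (aestronglyMeasurable_weakPartial (Ω := Ω) i f)
      ((aestronglyMeasurable_weakPartial (Ω := Ω) i f).sub
        ((hφ (σ k)).continuous_partialDeriv i).aestronglyMeasurable) (by norm_num)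
    simpa using this

/-! ### Hardy's inequality -/

/-- Since `P ∉ Ω`, a test function vanishes near `P`, and the singular weight does no harm. -/
lemma IsTestFunction.continuous_rpow_smul {φ : E n → ℂ} (hφ : IsTestFunction Ω φ) {P : E n}
    (hP : P ∉ Ω) (β : ℝ) : Continuous fun Q => ‖Q - P‖ ^ (-β) • φ Q := by
  rw [continuous_iff_continuousAt]
  intro Q
  by_cases hQ : Q = P
  · have h0 : φ =ᶠ[𝓝 Q] 0 := notMem_tsupport_iff_eventuallyEq.1 fun h => hP (hQ ▸ hφ.2.2 h)
    refine (continuousAt_const (y := (0 : ℂ))).congr ?_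
    filter_upwards [h0] with x hx
    simp [hx]
  · have h1 : ContinuousAt (fun Q => ‖Q - P‖ ^ (-β)) Q :=
      ContinuousAt.rpow_const (by fun_prop) (Or.inl (norm_ne_zero_iff.2 (sub_ne_zero.2 hQ)))
    exact h1.smul hφ.1.continuous.continuousAt

/-- The constant is `2^{n/2 - β}`, which is `1` only for `n = 2β`; but `1 < 2β < 2` and `n` is an
integer. -/
lemma hardy_constant_ne_one {β : ℝ} (hβ : 1 / 2 < β) (hβ1 : β < 1) :
    (2 : ℝ) ^ (-β) * Real.sqrt (2 ^ n) ≠ 1 := by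
  intro h
  have h2 : Real.sqrt (2 ^ n) = (2 : ℝ) ^ ((n : ℝ) / 2) := by
    rw [Real.sqrt_eq_rpow, ← Real.rpow_natCast, ← Real.rpow_mul (by norm_num)]
    congr 1; ring
  rw [h2, ← Real.rpow_add (by norm_num)] at h
  have h3 := congrArg Real.log h
  rw [Real.log_rpow (by norm_num), Real.log_one, mul_eq_zero,
    or_iff_left (Real.log_pos (by norm_num)).ne'] at h3
  have h4 : (n : ℝ) = 2 * β := by linarith
  have h5 : (1 : ℝ) < n := by linarith
  have h6 : (n : ℝ) < 2 := by linarith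
  norm_cast at h5 h6
  omega

/-- Compare `w = r^{-β} φ` with `v = r^{-β} φ ∘ T`, `T` being the homothety of ratio `1/2`. Scaling
gives `‖v‖ = c ‖w‖` with `c ≠ 1`, so `|c - 1| ‖w‖ ≤ ‖w - v‖`, and `w - v` is a weighted increment.
Finiteness of `‖w‖` is essential for this absorption. -/
lemma IsTestFunction.hardy {P : E n} (hP : P ∉ Ω) {D β : ℝ}
    (hD : ∀ Q ∈ Ω, ‖Q - P‖ ≤ D) (hβ : 1 / 2 < β) (hβ1 : β < 1) {φ : E n → ℂ}
    (hφ : IsTestFunction Ω φ) :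
    ∫⁻ Q, ‖‖Q - P‖ ^ (-β) • φ Q‖ₑ ^ 2 ≤
      ENNReal.ofReal (((2 ^ (-β) * Real.sqrt (2 ^ n) - 1) ^ 2)⁻¹ *
        ((2 * D) ^ (2 - 2 * β) * (1 - 1 / 2) ^ 2 * ((1 / 2) ^ n)⁻¹)) *
        ∫⁻ Q, ‖fderiv ℝ φ Q‖ₑ ^ 2 := by
  set w : E n → ℂ := fun Q => ‖Q - P‖ ^ (-β) • φ Q with hw
  set T : E n → E n := fun Q => P + (1 / 2 : ℝ) • (Q - P) with hT
  set v : E n → ℂ := fun Q => ‖Q - P‖ ^ (-β) • φ (T Q) with hv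
  have hwc : Continuous w := hφ.continuous_rpow_smul hP β
  have hwL : MemLp w 2 volume := by
    refine hwc.memLp_of_hasCompactSupport (hφ.2.1.mono fun Q hQ h => hQ ?_)
    simp [hw, h]
  have hvw : v = (2 : ℝ) ^ (-β) • (w ∘ T) := by
    ext Q
    simp only [hv, hw, hT, Pi.smul_apply, Function.comp, add_sub_cancel_left, norm_smul]
    rw [Real.mul_rpow (by positivity) (norm_nonneg _), smul_smul, ← mul_assoc,
      ← Real.mul_rpow (by norm_num) (by positivity)]
    norm_num
  have hTm : Measurable T := by fun_prop
  have hTc : Continuous T := by fun_prop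
  have hwT : eLpNorm (w ∘ T) 2 volume ^ 2 = ENNReal.ofReal (2 ^ n) * eLpNorm w 2 volume ^ 2 := by
    rw [eLpNorm_two_sq, eLpNorm_two_sq]
    have := lintegral_homothety P (u := 1 / 2) (by norm_num) (fun Q => ‖w Q‖ₑ ^ 2)
    simpa [hT] using this
  have hvm : AEStronglyMeasurable v volume := by
    rw [hvw]
    exact ((hwc.comp hTc).const_smul _).aestronglyMeasurable
  have hvn : eLpNorm v 2 volume ^ 2 =
      ENNReal.ofReal ((2 ^ (-β) * Real.sqrt (2 ^ n)) ^ 2) * eLpNorm w 2 volume ^ 2 := by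
    rw [hvw, eLpNorm_const_smul, mul_pow, hwT, Real.enorm_eq_ofReal (by positivity), ← mul_assoc,
      ← ENNReal.ofReal_pow (by positivity), ← ENNReal.ofReal_mul (by positivity), mul_pow,
      Real.sq_sqrt (by positivity)]
  have hvL : MemLp v 2 volume := by
    refine ⟨hvm, ?_⟩
    have : eLpNorm v 2 volume ^ 2 ≠ ⊤ := by
      rw [hvn]
      exact ENNReal.mul_ne_top ENNReal.ofReal_ne_top (ENNReal.pow_ne_top hwL.2.ne)
    exact lt_top_iff_ne_top.2 fun h => this (by simp [h])
  set c : ℝ := 2 ^ (-β) * Real.sqrt (2 ^ n) with hc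
  have hc0 : 0 ≤ c := by positivity
  have hc1 : c - 1 ≠ 0 := sub_ne_zero.2 (hardy_constant_ne_one hβ hβ1)
  set N : ℝ := (eLpNorm w 2 volume).toReal with hN
  set X : ℝ := (eLpNorm (w - v) 2 volume).toReal with hX
  have hvN : (eLpNorm v 2 volume).toReal = c * N := by
    have := congrArg ENNReal.toReal hvn
    rw [ENNReal.toReal_mul, ENNReal.toReal_pow, ENNReal.toReal_pow,
      ENNReal.toReal_ofReal (by positivity), ← mul_pow] at this
    exact (pow_left_inj₀ ENNReal.toReal_nonneg (mul_nonneg hc0 ENNReal.toReal_nonneg)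
      two_ne_zero).1 this
  have hXL : MemLp (w - v) 2 volume := hwL.sub hvL
  have t1 : N ≤ X + c * N := by
    have := eLpNorm_add_le (p := 2) hXL.1 hvL.1 (by norm_num)
    rw [sub_add_cancel] at this
    have := ENNReal.toReal_mono (ENNReal.add_ne_top.2 ⟨hXL.2.ne, hvL.2.ne⟩) this
    rwa [ENNReal.toReal_add hXL.2.ne hvL.2.ne, hvN] at this
  have t2 : c * N ≤ N + X := by
    have := eLpNorm_sub_le (p := 2) hwL.1 hXL.1 (by norm_num)
    rw [sub_sub_cancel] at this
    have := ENNReal.toReal_mono (ENNReal.add_ne_top.2 ⟨hwL.2.ne, hXL.2.ne⟩) this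
    rwa [ENNReal.toReal_add hwL.2.ne hXL.2.ne, hvN] at this
  have t3 : N ^ 2 ≤ ((c - 1) ^ 2)⁻¹ * X ^ 2 := by
    rw [inv_mul_eq_div, le_div_iff₀ (by positivity)]
    have : |(c - 1) * N| ≤ X := abs_le.2 ⟨by linarith, by linarith⟩
    calc N ^ 2 * (c - 1) ^ 2 = |(c - 1) * N| ^ 2 := by rw [sq_abs]; ring
      _ ≤ X ^ 2 := pow_le_pow_left₀ (abs_nonneg _) this 2
  have t4 : eLpNorm w 2 volume ^ 2 ≤
      ENNReal.ofReal ((c - 1) ^ 2)⁻¹ * eLpNorm (w - v) 2 volume ^ 2 := by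
    rw [← ENNReal.ofReal_toReal hwL.2.ne, ← ENNReal.ofReal_toReal hXL.2.ne,
      ← ENNReal.ofReal_pow ENNReal.toReal_nonneg, ← ENNReal.ofReal_pow ENNReal.toReal_nonneg,
      ← ENNReal.ofReal_mul (by positivity)]
    exact ENNReal.ofReal_le_ofReal t3
  have t5 : eLpNorm (w - v) 2 volume ^ 2 ≤
      ENNReal.ofReal ((2 * D) ^ (2 - 2 * β) * (1 - 1 / 2) ^ 2 * ((1 / 2) ^ n)⁻¹) *
        ∫⁻ Q, ‖fderiv ℝ φ Q‖ₑ ^ 2 := by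
    rw [eLpNorm_two_sq]
    -- The radius is `2D` because `φ ∘ T` lives where `‖Q - P‖ / 2 ≤ D`; both `w` and `v` vanish
    -- outside this ball.
    have hS : MeasurableSet (Metric.closedBall P (2 * D)) := Metric.isClosed_closedBall.measurableSet
    have := lintegral_increment_le (hφ.1.of_le (by norm_num)) P hS (D := 2 * D) (β := β)
      (fun Q hQ => by simpa [dist_eq_norm] using hQ) hβ1 (u := 1 / 2) (by norm_num) (by norm_num)
    refine le_trans (le_of_eq ?_) this
    rw [← lintegral_indicator hS]
    refine lintegral_congr fun Q => ?_
    by_cases hQ : Q ∈ Metric.closedBall P (2 * D)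
    · rw [Set.indicator_of_mem hQ]
      simp only [Pi.sub_apply, hw, hv, hT, smul_sub]
    · rw [Set.indicator_of_notMem hQ]
      rw [Metric.mem_closedBall, dist_eq_norm, not_le] at hQ
      have z1 : φ (T Q) = 0 := image_eq_zero_of_notMem_tsupport fun h => by
        have := hD _ (hφ.2.2 h)
        rw [hT] at this
        simp only [add_sub_cancel_left, norm_smul] at this
        norm_num at this
        linarith
      have z2 : φ Q = 0 := image_eq_zero_of_notMem_tsupport fun h => by
        have := hD _ (hφ.2.2 h)
        linarith [norm_nonneg (Q - P)]
      simp [hw, hv, z1, z2]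
  rw [← eLpNorm_two_sq, ENNReal.ofReal_mul (by positivity), mul_assoc]
  exact t4.trans (mul_le_mul_right t5 _)

end energy


/-! ### The `L_2` bound for Kipriyanov's operator -/

lemma lintegral_beta_ne_top {p q : ℝ} (hp : 0 < p) (hq : 0 < q) :
    ∫⁻ u in Set.Ioo (0 : ℝ) 1, ENNReal.ofReal (u ^ (p - 1) * (1 - u) ^ (q - 1)) ≠ ⊤ := by
  have h := Complex.betaIntegral_convergent (u := (p : ℂ)) (v := (q : ℂ)) (by simpa) (by simpa)
  rw [intervalIntegrable_iff_integrableOn_Ioo_of_le zero_le_one] at h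
  have h2 := h.2.ne
  rw [show (∫⁻ u in Set.Ioo (0 : ℝ) 1, ENNReal.ofReal (u ^ (p - 1) * (1 - u) ^ (q - 1))) = _ from ?_]
  · exact h2
  refine setLIntegral_congr_fun measurableSet_Ioo fun u hu => ?_
  have h1u : 0 < 1 - u := sub_pos.2 hu.2
  have e1 : ((p : ℂ) - 1) = ((p - 1 : ℝ) : ℂ) := by push_cast; ring
  have e2 : ((q : ℂ) - 1) = ((q - 1 : ℝ) : ℂ) := by push_cast; ring
  have e3 : (1 - (u : ℂ)) = ((1 - u : ℝ) : ℂ) := by push_cast; ring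
  simp only [e1, e2, e3, ← ofReal_norm]
  rw [norm_mul, Complex.norm_cpow_eq_rpow_re_of_pos hu.1, Complex.norm_cpow_eq_rpow_re_of_pos h1u]
  simp

section kipriyanov

variable {n : ℕ} {Ω : Set (E n)}

lemma MemH10.increment_le (hΩo : IsOpen Ω) (hΩc : Convex ℝ Ω) {P : E n} (hP : P ∈ closure Ω)
    {D β : ℝ} (hD : ∀ Q ∈ Ω, ‖Q - P‖ ≤ D) (hβ : β < 1) {u : ℝ} (hu : 0 < u) (hu1 : u ≤ 1)
    {f : E n → ℂ} (hf : MemH10 Ω f) :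
    ∫⁻ Q in Ω, ‖‖Q - P‖ ^ (-β) • (f Q - f (P + u • (Q - P)))‖ₑ ^ 2 ≤
      (ENNReal.ofReal (D ^ (2 - 2 * β) * (1 - u) ^ 2 * (u ^ n)⁻¹) * n) * energy Ω f := by
  obtain ⟨φ, g, hφ, hae, hg, hb⟩ := hf.exists_approx
  have hm : Measurable fun Q : E n => ‖Q - P‖ ^ (-β) := by fun_prop
  refine lintegral_enorm_sq_le_of_tendsto
    (w := fun k Q => ‖Q - P‖ ^ (-β) • (φ k Q - φ k (P + u • (Q - P)))) (fun k => ?_) ?_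
    (ENNReal.mul_ne_top ENNReal.ofReal_ne_top (ENNReal.natCast_ne_top n)) hg fun k => ?_
  · have := (hφ k).1.continuous
    have h2 : Continuous fun Q => φ k Q - φ k (P + u • (Q - P)) := by fun_prop
    exact hm.aestronglyMeasurable.smul h2.aestronglyMeasurable
  · filter_upwards [hae,
      (quasiMeasurePreserving_homothety hΩo hΩc hP hu hu1).ae hae] with Q h1 h2
    exact (h1.sub h2).const_smul _
  · refine (lintegral_increment_le ((hφ k).1.of_le (by norm_num)) P hΩo.measurableSet hD hβ hu
      hu1).trans ?_
    rw [mul_assoc (ENNReal.ofReal _)]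
    refine mul_le_mul_right ((lintegral_fderiv_le hΩo (hφ k)).trans ?_) _
    exact mul_le_mul_right (hb k) _

lemma exists_hardy_bound (hΩo : IsOpen Ω) {P : E n} (hP : P ∉ Ω) {D α : ℝ}
    (hD : ∀ Q ∈ Ω, ‖Q - P‖ ≤ D) (hα : 0 < α) (hα1 : α < 1) :
    ∃ C : ENNReal, C ≠ ⊤ ∧ ∀ f : E n → ℂ, MemH10 Ω f →
      ∫⁻ Q in Ω, ‖‖Q - P‖ ^ (-α) • f Q‖ₑ ^ 2 ≤ C * energy Ω f := by
  -- An exponent in `(1/2, 1)` above `α`: Hardy's inequality is applied with `β`, avoiding the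
  -- critical case `n = 1`, `α = 1/2` of the scaling argument, and `r^{-α} ≤ D^{β-α} r^{-β}` returns
  -- to `α`.
  set β : ℝ := (1 + α) / 2 with hβ
  set C₀ : ENNReal := ENNReal.ofReal (((2 ^ (-β) * Real.sqrt (2 ^ n) - 1) ^ 2)⁻¹ *
        ((2 * D) ^ (2 - 2 * β) * (1 - 1 / 2) ^ 2 * ((1 / 2) ^ n)⁻¹)) * n with hC₀
  have hC₀' : C₀ ≠ ⊤ := ENNReal.mul_ne_top ENNReal.ofReal_ne_top (ENNReal.natCast_ne_top n)
  refine ⟨ENNReal.ofReal ((D ^ (β - α)) ^ 2) * C₀,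
    ENNReal.mul_ne_top ENNReal.ofReal_ne_top hC₀', fun f hf => ?_⟩
  have h1 : ∫⁻ Q in Ω, ‖‖Q - P‖ ^ (-β) • f Q‖ₑ ^ 2 ≤ C₀ * energy Ω f := by
    obtain ⟨φ, g, hφ, hae, hg, hb⟩ := hf.exists_approx
    refine lintegral_enorm_sq_le_of_tendsto
      (w := fun k Q => ‖Q - P‖ ^ (-β) • φ k Q) (fun k => ?_) ?_ hC₀' hg fun k => ?_
    · exact ((hφ k).continuous_rpow_smul hP β).aestronglyMeasurable
    · filter_upwards [hae] with Q h1
      exact h1.const_smul _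
    · refine (setLIntegral_le_lintegral Ω _).trans (((hφ k).hardy hP hD (by linarith)
        (by linarith)).trans ?_)
      rw [hC₀, mul_assoc (ENNReal.ofReal _)]
      refine mul_le_mul_right ((lintegral_fderiv_le hΩo (hφ k)).trans ?_) _
      exact mul_le_mul_right (hb k) _
  calc _ ≤ ∫⁻ Q in Ω, ENNReal.ofReal ((D ^ (β - α)) ^ 2) * ‖‖Q - P‖ ^ (-β) • f Q‖ₑ ^ 2 := by
        refine setLIntegral_mono' hΩo.measurableSet fun Q hQ => ?_
        have hr : 0 < ‖Q - P‖ := norm_pos_iff.2 (sub_ne_zero.2 fun h => hP (h ▸ hQ))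
        rw [ENNReal.ofReal_pow (Real.rpow_nonneg (hr.le.trans (hD Q hQ)) _), ← mul_pow,
          enorm_smul, enorm_smul, ← mul_assoc, Real.enorm_eq_ofReal (by positivity),
          Real.enorm_eq_ofReal (by positivity),
          ← ENNReal.ofReal_mul (Real.rpow_nonneg (hr.le.trans (hD Q hQ)) _)]
        refine pow_le_pow_left' (mul_le_mul_left (ENNReal.ofReal_le_ofReal ?_) _) 2
        calc ‖Q - P‖ ^ (-α) = ‖Q - P‖ ^ (β - α) * ‖Q - P‖ ^ (-β) := by
              rw [← Real.rpow_add hr]; congr 1; ring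
          _ ≤ _ := by
            have := Real.rpow_le_rpow hr.le (hD Q hQ) (by linarith : 0 ≤ β - α)
            gcongr
    _ ≤ _ := by
      rw [lintegral_const_mul' _ _ ENNReal.ofReal_ne_top, mul_assoc]
      exact mul_le_mul_right h1 _

/-- The integrand of Kipriyanov's operator after the substitution `t = ru`. -/
noncomputable def kernelInc (P : E n) (α : ℝ) (f : E n → ℂ) (u : ℝ) (Q : E n) : ℂ :=
  (u ^ (n - 1) / (1 - u) ^ (α + 1)) • ‖Q - P‖ ^ (-α) • (f Q - f (P + u • (Q - P)))

lemma kipriyanov_eq {P Q : E n} (hQ : Q ≠ P) (α : ℝ) (f : E n → ℂ) :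
    kipriyanov P α f Q =
      ((α / Real.Gamma (1 - α) : ℝ) : ℂ) * (∫ u in Set.Ioo (0 : ℝ) 1, kernelInc P α f u Q)
      + (((n - 1).factorial / Real.Gamma (n - α) : ℝ) : ℂ) * (‖Q - P‖ ^ (-α) • f Q) := by
  have hr : 0 < ‖Q - P‖ := norm_pos_iff.2 (sub_ne_zero.2 hQ)
  unfold kipriyanov
  simp only
  congr 1
  · congr 1
    have h := intervalIntegral.smul_integral_comp_mul_left (a := 0) (b := 1)
      (fun t : ℝ => (((t / ‖Q - P‖) ^ (n - 1) / (‖Q - P‖ - t) ^ (α + 1) : ℝ) : ℂ) *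
        (f Q - f (P + t • (‖Q - P‖⁻¹ • (Q - P))))) ‖Q - P‖
    rw [mul_zero, mul_one] at h
    rw [← h, intervalIntegral.integral_of_le zero_le_one, integral_Ioc_eq_integral_Ioo,
      ← integral_smul]
    refine setIntegral_congr_fun measurableSet_Ioo fun u hu => ?_
    have h1u : 0 < 1 - u := sub_pos.2 hu.2
    simp only [kernelInc]
    rw [smul_smul (‖Q - P‖ * u), mul_right_comm, mul_inv_cancel₀ hr.ne', one_mul,
      mul_div_cancel_left₀ _ hr.ne', show ‖Q - P‖ - ‖Q - P‖ * u = ‖Q - P‖ * (1 - u) by ring,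
      Real.mul_rpow hr.le h1u.le, smul_smul, Real.rpow_neg hr.le, Real.rpow_add hr, Real.rpow_one]
    rw [← Complex.real_smul, smul_smul]
    congr 1
    field_simp
  · rw [Complex.real_smul]
    push_cast
    ring

lemma aestronglyMeasurable_kernelInc (hΩo : IsOpen Ω) (hΩc : Convex ℝ Ω) {P : E n}
    (hP : P ∈ closure Ω) (α : ℝ) {f : E n → ℂ}
    (hf : AEStronglyMeasurable f (volume.restrict Ω)) :
    AEStronglyMeasurable (fun z : ℝ × E n => kernelInc P α f z.1 z.2)
      ((volume.restrict (Set.Ioo (0 : ℝ) 1)).prod (volume.restrict Ω)) := by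
  have h1 : AEStronglyMeasurable (fun z : ℝ × E n => f z.2)
    ((volume.restrict (Set.Ioo (0 : ℝ) 1)).prod (volume.restrict Ω)) := hf.comp_snd
  have h2 := hf.comp_quasiMeasurePreserving (quasiMeasurePreserving_homothety_prod hΩo hΩc hP)
  have h3 : Measurable fun z : ℝ × E n => z.1 ^ (n - 1) / (1 - z.1) ^ (α + 1) := by fun_prop
  have h4 : Measurable fun z : ℝ × E n => ‖z.2 - P‖ ^ (-α) := by fun_prop
  exact h3.aestronglyMeasurable.smul (h4.aestronglyMeasurable.smul (h1.sub h2))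

/-- A weighted Cauchy–Schwarz inequality in `u` takes the place of Minkowski's integral inequality
and yields the same constant, the square of a Beta integral. -/
lemma MemH10.lintegral_integral_kernelInc_le (hn : 0 < n) (hΩo : IsOpen Ω) (hΩc : Convex ℝ Ω)
    {P : E n} (hP : P ∈ closure Ω) {D α : ℝ} (hD : ∀ Q ∈ Ω, ‖Q - P‖ ≤ D)
    (hα1 : α < 1) {f : E n → ℂ} (hf : MemH10 Ω f) :
    ∫⁻ Q in Ω, ‖∫ u in Set.Ioo (0 : ℝ) 1, kernelInc P α f u Q‖ₑ ^ 2 ≤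
      ((∫⁻ u in Set.Ioo (0 : ℝ) 1,
        ENNReal.ofReal (u ^ ((n : ℝ) / 2 - 1) * (1 - u) ^ ((1 - α) - 1))) ^ 2 *
        (ENNReal.ofReal (D ^ (2 - 2 * α)) * n)) * energy Ω f := by
  -- `k` is the kernel times `(1-u) u^{-n/2}`, the size of the increment in `L_2`. The weight `m` is
  -- fixed by two demands: `√k √m` is the kernel, and `m` times the squared increment bound is again
  -- a multiple of `k`.
  set k : ℝ → ℝ := fun u => u ^ ((n : ℝ) / 2 - 1) * (1 - u) ^ ((1 - α) - 1) with hk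
  set m : ℝ → ℝ := fun u => u ^ (n : ℝ) * (1 - u) ^ (-2 : ℝ) * k u with hm
  set inc : ℝ → E n → ℂ := fun u Q => ‖Q - P‖ ^ (-α) • (f Q - f (P + u • (Q - P))) with hinc
  set B : ENNReal := ∫⁻ u in Set.Ioo (0 : ℝ) 1, ENNReal.ofReal (k u) with hB
  have hf2 : AEStronglyMeasurable f (volume.restrict Ω) := hf.1.1.1
  have hk0 : ∀ u ∈ Set.Ioo (0 : ℝ) 1, 0 < k u := fun u hu =>
    mul_pos (Real.rpow_pos_of_pos hu.1 _) (Real.rpow_pos_of_pos (sub_pos.2 hu.2) _)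
  have hm0 : ∀ u ∈ Set.Ioo (0 : ℝ) 1, 0 < m u := fun u hu =>
    mul_pos (mul_pos (Real.rpow_pos_of_pos hu.1 _) (Real.rpow_pos_of_pos (sub_pos.2 hu.2) _))
      (hk0 u hu)
  have hkm : Measurable k := by fun_prop
  have hmm : Measurable m := by fun_prop
  have hwt : ∀ u ∈ Set.Ioo (0 : ℝ) 1,
      u ^ (n - 1) / (1 - u) ^ (α + 1) = Real.sqrt (k u) * Real.sqrt (m u) := by
    intro u hu
    have h1u : 0 < 1 - u := sub_pos.2 hu.2
    rw [← Real.sqrt_mul (hk0 u hu).le]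
    symm
    rw [Real.sqrt_eq_iff_mul_self_eq (mul_pos (hk0 u hu) (hm0 u hu)).le
      (div_nonneg (pow_nonneg hu.1.le _) (Real.rpow_nonneg h1u.le _))]
    simp only [hm, hk]
    rw [div_eq_mul_inv (u ^ (n - 1)), ← Real.rpow_neg h1u.le, ← Real.rpow_natCast, Nat.cast_sub hn]
    symm
    calc _ = (u ^ ((n : ℝ) - (1 : ℕ)) * u ^ ((n : ℝ) - (1 : ℕ))) *
          ((1 - u) ^ (-(α + 1)) * (1 - u) ^ (-(α + 1))) := by ring
      _ = (u ^ ((n : ℝ) / 2 - 1) * u ^ ((n : ℝ) / 2 - 1) * u ^ (n : ℝ)) *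
          ((1 - u) ^ (1 - α - 1) * (1 - u) ^ (1 - α - 1) * (1 - u) ^ (-2 : ℝ)) := by
        simp only [← Real.rpow_add hu.1, ← Real.rpow_add h1u]
        congr 2 <;> push_cast <;> ring
      _ = _ := by ring
  have him : AEStronglyMeasurable (fun z : ℝ × E n => inc z.1 z.2)
      ((volume.restrict (Set.Ioo (0 : ℝ) 1)).prod (volume.restrict Ω)) := by
    have h1 : AEStronglyMeasurable (fun z : ℝ × E n => f z.2)
      ((volume.restrict (Set.Ioo (0 : ℝ) 1)).prod (volume.restrict Ω)) := hf2.comp_snd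
    have h2 := hf2.comp_quasiMeasurePreserving
      (quasiMeasurePreserving_homothety_prod hΩo hΩc hP)
    have h4 : Measurable fun z : ℝ × E n => ‖z.2 - P‖ ^ (-α) := by fun_prop
    exact h4.aestronglyMeasurable.smul (h1.sub h2)
  have hjm' : AEMeasurable (fun z : ℝ × E n => ENNReal.ofReal (m z.1) * ‖inc z.1 z.2‖ₑ ^ 2)
      ((volume.restrict (Set.Ioo (0 : ℝ) 1)).prod (volume.restrict Ω)) :=
    (hmm.comp measurable_fst).ennreal_ofReal.aemeasurable.mul (him.enorm.pow_const 2)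
  have hsl : ∀ᵐ Q ∂(volume.restrict Ω), AEMeasurable (fun u => ‖inc u Q‖ₑ)
      (volume.restrict (Set.Ioo (0 : ℝ) 1)) := by
    filter_upwards [him.prod_swap.prodMk_left] with Q hQ
    exact hQ.enorm
  have hpt : ∀ᵐ Q ∂(volume.restrict Ω),
      ‖∫ u in Set.Ioo (0 : ℝ) 1, kernelInc P α f u Q‖ₑ ^ 2 ≤
        B * ∫⁻ u in Set.Ioo (0 : ℝ) 1, ENNReal.ofReal (m u) * ‖inc u Q‖ₑ ^ 2 := by
    filter_upwards [hsl] with Q hQ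
    have e2 : ∀ x : ℝ, 0 ≤ x → ENNReal.ofReal (Real.sqrt x) ^ 2 = ENNReal.ofReal x :=
      fun x hx => by rw [← ENNReal.ofReal_pow (Real.sqrt_nonneg _), Real.sq_sqrt hx]
    calc _ ≤ (∫⁻ u in Set.Ioo (0 : ℝ) 1, ENNReal.ofReal (Real.sqrt (k u)) *
          (ENNReal.ofReal (Real.sqrt (m u)) * ‖inc u Q‖ₑ)) ^ 2 := by
          refine pow_le_pow_left' ((enorm_integral_le_lintegral_enorm _).trans (le_of_eq ?_)) 2
          refine setLIntegral_congr_fun measurableSet_Ioo fun u hu => ?_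
          simp only [kernelInc]
          rw [enorm_smul, hwt u hu, Real.enorm_eq_ofReal (by positivity),
            ENNReal.ofReal_mul (by positivity), mul_assoc]
      _ ≤ _ := lintegral_mul_sq_le _ (by fun_prop) (AEMeasurable.mul (by fun_prop) hQ)
      _ = _ := by
        congr 1
        · exact setLIntegral_congr_fun measurableSet_Ioo fun u hu => e2 _ (hk0 u hu).le
        · refine setLIntegral_congr_fun measurableSet_Ioo fun u hu => ?_
          simp only [mul_pow, e2 _ (hm0 u hu).le]
  have hB' : B ≠ ⊤ := lintegral_beta_ne_top (by positivity) (by linarith)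
  calc _ ≤ ∫⁻ Q in Ω, B * ∫⁻ u in Set.Ioo (0 : ℝ) 1, ENNReal.ofReal (m u) * ‖inc u Q‖ₑ ^ 2 :=
        lintegral_mono_ae hpt
    _ = B * ∫⁻ u in Set.Ioo (0 : ℝ) 1, ENNReal.ofReal (m u) * ∫⁻ Q in Ω, ‖inc u Q‖ₑ ^ 2 := by
      rw [lintegral_const_mul' _ _ hB', ← lintegral_lintegral_swap hjm']
      simp_rw [lintegral_const_mul' _ _ ENNReal.ofReal_ne_top]
    _ ≤ B * ∫⁻ u in Set.Ioo (0 : ℝ) 1, ENNReal.ofReal (k u) *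
        (ENNReal.ofReal (D ^ (2 - 2 * α)) * n * energy Ω f) := by
      refine mul_le_mul_right (setLIntegral_mono' measurableSet_Ioo fun u hu => ?_) _
      have h1u : 0 < 1 - u := sub_pos.2 hu.2
      refine (mul_le_mul_right (hf.increment_le hΩo hΩc hP hD hα1 hu.1 hu.2.le) _).trans ?_
      rw [← mul_assoc, ← mul_assoc, ← mul_assoc, ← mul_assoc,
        ← ENNReal.ofReal_mul (hm0 u hu).le, ← ENNReal.ofReal_mul (hk0 u hu).le]
      refine le_of_eq ?_
      congr 3
      have hu0 := hu.1
      simp only [hm]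
      rw [Real.rpow_neg h1u.le, Real.rpow_natCast, Real.rpow_ofNat]
      field_simp
    _ = _ := by
      rw [lintegral_mul_const _ (by fun_prop)]
      ring

lemma exists_eLpNorm_kipriyanov_sq_le (hn : 0 < n) (hΩo : IsOpen Ω) (hΩc : Convex ℝ Ω)
    (hΩb : Bornology.IsBounded Ω) {P : E n} (hP : P ∈ frontier Ω) {α : ℝ} (hα : 0 < α)
    (hα1 : α < 1) : ∃ C : ENNReal, C ≠ ⊤ ∧ ∀ f : E n → ℂ, MemH10 Ω f →
      AEStronglyMeasurable (kipriyanov P α f) (volume.restrict Ω) ∧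
      eLpNorm (kipriyanov P α f) 2 (volume.restrict Ω) ^ 2 ≤ C * energy Ω f := by
  have hPc : P ∈ closure Ω := frontier_subset_closure hP
  have hPn : P ∉ Ω := fun h => by
    rw [hΩo.frontier_eq] at hP
    exact hP.2 h
  obtain ⟨D, hD⟩ : ∃ D, ∀ Q ∈ Ω, ‖Q - P‖ ≤ D := by
    obtain ⟨D, hD⟩ := hΩb.subset_closedBall P
    exact ⟨D, fun Q hQ => by simpa [dist_eq_norm] using hD hQ⟩
  obtain ⟨C₂, hC₂, h2⟩ := exists_hardy_bound hΩo hPn hD hα hα1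
  set C₁ : ENNReal := (∫⁻ u in Set.Ioo (0 : ℝ) 1,
        ENNReal.ofReal (u ^ ((n : ℝ) / 2 - 1) * (1 - u) ^ ((1 - α) - 1))) ^ 2 *
        (ENNReal.ofReal (D ^ (2 - 2 * α)) * n) with hC₁
  have hC₁' : C₁ ≠ ⊤ :=
    ENNReal.mul_ne_top (ENNReal.pow_ne_top (lintegral_beta_ne_top (by positivity) (by linarith)))
      (ENNReal.mul_ne_top ENNReal.ofReal_ne_top (ENNReal.natCast_ne_top n))
  set c₁ : ℂ := ((α / Real.Gamma (1 - α) : ℝ) : ℂ)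
  set c₂ : ℂ := (((n - 1).factorial / Real.Gamma (n - α) : ℝ) : ℂ)
  refine ⟨2 * (‖c₁‖ₑ ^ 2 * C₁ + ‖c₂‖ₑ ^ 2 * C₂), by finiteness, fun f hf => ?_⟩
  have hf2 : AEStronglyMeasurable f (volume.restrict Ω) := hf.1.1.1
  have heq : kipriyanov P α f =ᵐ[volume.restrict Ω] fun Q =>
      c₁ * (∫ u in Set.Ioo (0 : ℝ) 1, kernelInc P α f u Q) + c₂ * (‖Q - P‖ ^ (-α) • f Q) := by
    filter_upwards [ae_restrict_mem hΩo.measurableSet] with Q hQ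
    exact kipriyanov_eq (ne_of_mem_of_not_mem hQ hPn) α f
  have hm1 : AEStronglyMeasurable (fun Q => ∫ u in Set.Ioo (0 : ℝ) 1, kernelInc P α f u Q)
      (volume.restrict Ω) :=
    (aestronglyMeasurable_kernelInc hΩo hΩc hPc α hf2).prod_swap.integral_prod_right'
  have hm2 : AEStronglyMeasurable (fun Q => ‖Q - P‖ ^ (-α) • f Q) (volume.restrict Ω) := by
    have h4 : Measurable fun Q : E n => ‖Q - P‖ ^ (-α) := by fun_prop
    exact h4.aestronglyMeasurable.smul hf2
  refine ⟨((hm1.const_mul c₁).add (hm2.const_mul c₂)).congr heq.symm, ?_⟩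
  rw [eLpNorm_congr_ae heq, eLpNorm_two_sq]
  calc _ ≤ ∫⁻ Q in Ω, 2 * (‖c₁‖ₑ ^ 2 * ‖∫ u in Set.Ioo (0 : ℝ) 1, kernelInc P α f u Q‖ₑ ^ 2 +
        ‖c₂‖ₑ ^ 2 * ‖‖Q - P‖ ^ (-α) • f Q‖ₑ ^ 2) := by
        refine lintegral_mono fun Q => ?_
        refine (pow_le_pow_left' (enorm_add_le _ _) 2).trans ((enn_add_sq_le _ _).trans ?_)
        rw [enorm_mul, enorm_mul, mul_pow, mul_pow]
    _ = 2 * (‖c₁‖ₑ ^ 2 * (∫⁻ Q in Ω, ‖∫ u in Set.Ioo (0 : ℝ) 1, kernelInc P α f u Q‖ₑ ^ 2) +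
        ‖c₂‖ₑ ^ 2 * ∫⁻ Q in Ω, ‖‖Q - P‖ ^ (-α) • f Q‖ₑ ^ 2) := by
      rw [lintegral_const_mul' _ _ (by norm_num),
        lintegral_add_left' ((hm1.enorm.pow_const 2).const_mul _),
        lintegral_const_mul' _ _ (by finiteness), lintegral_const_mul' _ _ (by finiteness)]
    _ ≤ 2 * (‖c₁‖ₑ ^ 2 * (C₁ * energy Ω f) + ‖c₂‖ₑ ^ 2 * (C₂ * energy Ω f)) := by
      have := hf.lintegral_integral_kernelInc_le hn hΩo hΩc hPc hD hα1
      have := h2 f hf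
      gcongr
    _ = _ := by ring

end kipriyanov


section weak

variable {n : ℕ} {Ω : Set (E n)}

/-! ### Continuously differentiable test functions -/

lemma integrableOn_mul_of_hasCompactSupport {f χ : E n → ℂ}
    (hf : LocallyIntegrableOn f Ω) (hχ : Continuous χ) (hχc : HasCompactSupport χ)
    (hχΩ : tsupport χ ⊆ Ω) : IntegrableOn (fun Q => f Q * χ Q) Ω := by
  have h1 : IntegrableOn (fun Q => f Q * χ Q) (tsupport χ) :=
    (hf.integrableOn_compact_subset hχΩ hχc).mul_continuousOn hχ.continuousOn hχc
  have h2 : Integrable (fun Q => f Q * χ Q) :=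
    (integrableOn_iff_integrable_of_support_subset fun Q hQ => subset_tsupport χ
      fun h => hQ (by simp [h])).1 h1
  exact h2.integrableOn

lemma norm_setIntegral_mul_le {f χ : E n → ℂ} {K : Set (E n)}
    (hf : LocallyIntegrableOn f Ω) (hK : IsCompact K) (hKΩ : K ⊆ Ω) {ε : ℝ}
    (hχK : ∀ Q ∉ K, χ Q = 0) (hχε : ∀ Q, ‖χ Q‖ ≤ ε) :
    ‖∫ Q in Ω, f Q * χ Q‖ ≤ ε * ∫ Q in K, ‖f Q‖ := by
  have h1 : ∫ Q in Ω, f Q * χ Q = ∫ Q in K, f Q * χ Q := by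
    rw [setIntegral_eq_integral_of_forall_compl_eq_zero fun Q hQ => by
        simp [hχK Q fun h => hQ (hKΩ h)],
      setIntegral_eq_integral_of_forall_compl_eq_zero fun Q hQ => by simp [hχK Q hQ]]
  rw [h1, ← integral_const_mul]
  refine norm_integral_le_of_norm_le
    ((hf.integrableOn_compact_subset hKΩ hK).norm.const_mul ε) (Eventually.of_forall fun Q => ?_)
  rw [norm_mul, mul_comm]
  exact mul_le_mul_of_nonneg_right (hχε Q) (norm_nonneg _)

/-- Mollification. The compact set `K` is chosen before `ε`, so that uniform smallness on `K`
controls integrals against functions that are merely locally integrable. -/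
lemma exists_isTestFunction_approx (hΩ : IsOpen Ω) {ψ : E n → ℂ} (hψ : ContDiff ℝ 1 ψ)
    (hψc : HasCompactSupport ψ) (hψΩ : tsupport ψ ⊆ Ω) :
    ∃ K : Set (E n), IsCompact K ∧ K ⊆ Ω ∧ tsupport ψ ⊆ K ∧ ∀ ε > 0, ∃ φ : E n → ℂ,
      IsTestFunction Ω φ ∧ tsupport φ ⊆ K ∧ (∀ Q, ‖ψ Q - φ Q‖ ≤ ε) ∧
      ∀ i Q, ‖partialDeriv i ψ Q - partialDeriv i φ Q‖ ≤ ε := by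
  obtain ⟨δ, hδ, hK⟩ := IsCompact.exists_cthickening_subset_open hψc hΩ hψΩ
  have hKc : IsCompact (Metric.cthickening δ (tsupport ψ)) := IsCompact.cthickening hψc
  refine ⟨_, hKc, hK, Metric.self_subset_cthickening _, fun ε hε => ?_⟩
  have hψd : Continuous (fderiv ℝ ψ) := hψ.continuous_fderiv (by norm_num)
  have hψdc : HasCompactSupport (fderiv ℝ ψ) := hψc.fderiv ℝ
  have hu1 := hψc.uniformContinuous_of_continuous hψ.continuous
  have hu2 := hψdc.uniformContinuous_of_continuous hψd
  obtain ⟨δ₁, hδ₁, h1⟩ := Metric.uniformContinuous_iff.1 hu1 ε hε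
  obtain ⟨δ₂, hδ₂, h2⟩ := Metric.uniformContinuous_iff.1 hu2 ε hε
  -- `δ` keeps the support in `K`; `δ₁` and `δ₂` are moduli of uniform continuity of `ψ` and of its
  -- derivative.
  set δ' : ℝ := min δ (min δ₁ δ₂) with hδ'
  have hδ'0 : 0 < δ' := lt_min hδ (lt_min hδ₁ hδ₂)
  let b : ContDiffBump (0 : E n) := ⟨δ' / 2, δ', by positivity, by linarith⟩
  have hbr : b.rOut = δ' := rfl
  set φ : E n → ℂ := convolution (b.normed volume) ψ (ContinuousLinearMap.lsmul ℝ ℝ) volume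
    with hφ
  have hbl : LocallyIntegrable (b.normed volume) (volume : Measure (E n)) :=
    b.continuous_normed.locallyIntegrable
  have hsupp : tsupport φ ⊆ Metric.cthickening δ (tsupport ψ) := by
    refine closure_minimal ?_ Metric.isClosed_cthickening
    refine (support_convolution_subset _).trans ?_
    rintro _ ⟨x, hx, y, hy, rfl⟩
    rw [b.support_normed_eq, hbr, mem_ball_zero_iff] at hx
    refine Metric.mem_cthickening_of_dist_le _ y _ _ (subset_tsupport _ hy) ?_
    simpa using hx.le.trans (min_le_left _ _)
  have hφd : ∀ i Q, partialDeriv i φ Q = convolution (b.normed volume) (partialDeriv i ψ)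
      (ContinuousLinearMap.lsmul ℝ ℝ) volume Q := by
    intro i Q
    have := hψc.hasFDerivAt_convolution_right (ContinuousLinearMap.lsmul ℝ ℝ) hbl hψ Q
    rw [partialDeriv, this.fderiv]
    exact convolution_precompR_apply _ hbl hψdc hψd Q _
  refine ⟨φ, ⟨?_, hKc.of_isClosed_subset (isClosed_tsupport _) hsupp, hsupp.trans hK⟩, hsupp,
    fun Q => ?_, fun i Q => ?_⟩
  · exact b.hasCompactSupport_normed.contDiff_convolution_left _ b.contDiff_normed
      hψ.continuous.locallyIntegrable
  · rw [← dist_eq_norm, dist_comm]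
    refine b.dist_normed_convolution_le hψ.continuous.aestronglyMeasurable fun x hx => ?_
    exact (h1 (lt_of_lt_of_le hx ((min_le_right _ _).trans (min_le_left _ _)))).le
  · rw [← dist_eq_norm, dist_comm, hφd]
    have hc : Continuous (partialDeriv i ψ) := by
      unfold partialDeriv
      fun_prop
    refine b.dist_normed_convolution_le hc.aestronglyMeasurable fun x hx => ?_
    have := h2 (lt_of_lt_of_le hx ((min_le_right _ _).trans (min_le_right _ _)))
    rw [dist_eq_norm] at this ⊢
    unfold partialDeriv
    rw [← sub_apply]
    refine (ContinuousLinearMap.le_opNorm _ _).trans ?_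
    simpa using this.le

/-- Needed for the product rule: a `C^1` coefficient times a smooth test function is only a `C^1`
test function. -/
lemma HasWeakPartial.integral_eq_of_contDiff_one (hΩ : IsOpen Ω) {i : Fin n} {f g : E n → ℂ}
    (h : HasWeakPartial Ω i f g) {ψ : E n → ℂ} (hψ : ContDiff ℝ 1 ψ)
    (hψc : HasCompactSupport ψ) (hψΩ : tsupport ψ ⊆ Ω) :
    ∫ Q in Ω, f Q * partialDeriv i ψ Q = -∫ Q in Ω, g Q * ψ Q := by
  obtain ⟨K, hKc, hKΩ, hψK, hap⟩ := exists_isTestFunction_approx hΩ hψ hψc hψΩ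
  have hsd : ∀ χ : E n → ℂ, tsupport (partialDeriv i χ) ⊆ tsupport χ := fun χ =>
    tsupport_fderiv_apply_subset ℝ _
  have hψd : Continuous (partialDeriv i ψ) := by
    have := hψ.continuous_fderiv (by norm_num)
    unfold partialDeriv
    fun_prop
  rw [← sub_eq_zero, ← norm_eq_zero]
  set M : ℝ := (∫ Q in K, ‖f Q‖) + ∫ Q in K, ‖g Q‖ with hM
  have hM0 : 0 ≤ M := by positivity
  refine le_antisymm (le_of_forall_pos_le_add fun ε hε => ?_) (norm_nonneg _)
  -- The total error is `M` times the tolerance; `M + 1` guards against `M = 0`.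
  obtain ⟨φ, hφ, hφK, h1, h2⟩ := hap (ε / (M + 1)) (by positivity)
  have e1 : ∫ Q in Ω, f Q * (partialDeriv i ψ Q - partialDeriv i φ Q) =
      (∫ Q in Ω, f Q * partialDeriv i ψ Q) - ∫ Q in Ω, f Q * partialDeriv i φ Q := by
    simp_rw [mul_sub]
    exact integral_sub
      (integrableOn_mul_of_hasCompactSupport h.1 hψd (hψc.fderiv_apply ℝ _) ((hsd _).trans hψΩ))
      (integrableOn_mul_of_hasCompactSupport h.1 (hφ.continuous_partialDeriv i)
        (hφ.hasCompactSupport_partialDeriv i) ((hsd _).trans hφ.2.2))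
  have e2 : ∫ Q in Ω, g Q * (ψ Q - φ Q) =
      (∫ Q in Ω, g Q * ψ Q) - ∫ Q in Ω, g Q * φ Q := by
    simp_rw [mul_sub]
    exact integral_sub
      (integrableOn_mul_of_hasCompactSupport h.2.1 hψ.continuous hψc hψΩ)
      (integrableOn_mul_of_hasCompactSupport h.2.1 hφ.1.continuous hφ.2.1 hφ.2.2)
  have hz : ∀ χ : E n → ℂ, tsupport χ ⊆ K → ∀ Q ∉ K, χ Q = 0 := fun χ hχ Q hQ =>
    image_eq_zero_of_notMem_tsupport fun h => hQ (hχ h)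
  have b1 := norm_setIntegral_mul_le (f := f)
    (χ := fun Q => partialDeriv i ψ Q - partialDeriv i φ Q) h.1 hKc hKΩ
    (fun Q hQ => by simp [hz _ ((hsd ψ).trans hψK) Q hQ, hz _ ((hsd φ).trans hφK) Q hQ]) (h2 i)
  have b2 := norm_setIntegral_mul_le (f := g) (χ := fun Q => ψ Q - φ Q) h.2.1 hKc hKΩ
    (fun Q hQ => by simp [hz _ hψK Q hQ, hz _ hφK Q hQ]) h1
  have e3 : (∫ Q in Ω, f Q * partialDeriv i ψ Q) - -∫ Q in Ω, g Q * ψ Q =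
      (∫ Q in Ω, f Q * (partialDeriv i ψ Q - partialDeriv i φ Q)) +
        ∫ Q in Ω, g Q * (ψ Q - φ Q) := by
    rw [e1, e2, h.2.2 φ hφ]
    ring
  rw [e3, zero_add]
  refine (norm_add_le _ _).trans ((add_le_add b1 b2).trans ?_)
  rw [← mul_add, ← hM, div_mul_eq_mul_div, div_le_iff₀ (by positivity)]
  nlinarith

/-! ### Uniqueness of weak derivatives -/

/-- The fundamental lemma of the calculus of variations, with real test functions read as complex
ones. It identifies the chosen `weakPartial` with any other weak derivative. -/
lemma HasWeakPartial.ae_eq (hΩ : IsOpen Ω) {i : Fin n} {f g h : E n → ℂ}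
    (hg : HasWeakPartial Ω i f g) (hh : HasWeakPartial Ω i f h) :
    g =ᵐ[volume.restrict Ω] h := by
  have key := hΩ.ae_eq_zero_of_integral_contDiff_smul_eq_zero (μ := volume)
    (hg.2.1.sub hh.2.1) fun χ hχ hχc hχΩ => ?_
  · rw [Filter.EventuallyEq, ae_restrict_iff' hΩ.measurableSet]
    filter_upwards [key] with Q hQ hQΩ
    exact sub_eq_zero.1 (hQ hQΩ)
  · set φ : E n → ℂ := fun Q => (χ Q : ℂ) with hφ
    have hs : tsupport φ ⊆ tsupport χ := closure_mono fun Q hQ h => hQ (by simp [hφ, h])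
    have hφt : IsTestFunction Ω φ := by
      refine ⟨Complex.ofRealCLM.contDiff.comp hχ, ?_, hs.trans hχΩ⟩
      exact hχc.of_isClosed_subset (isClosed_tsupport _) hs
    have e1 := (hg.2.2 φ hφt).symm.trans (hh.2.2 φ hφt)
    have e2 : ∫ Q in Ω, (g Q * φ Q - h Q * φ Q) = 0 := by
      rw [integral_sub
        (integrableOn_mul_of_hasCompactSupport hg.2.1 hφt.1.continuous hφt.2.1 hφt.2.2)
        (integrableOn_mul_of_hasCompactSupport hh.2.1 hφt.1.continuous hφt.2.1 hφt.2.2)]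
      rw [neg_inj.1 e1, sub_self]
    rw [setIntegral_eq_integral_of_forall_compl_eq_zero fun Q hQ => by
      simp [image_eq_zero_of_notMem_tsupport fun h' => hQ (hφt.2.2 h')]] at e2
    rw [← e2]
    refine integral_congr_ae (Eventually.of_forall fun Q => ?_)
    simp only [hφ, Pi.sub_apply, Complex.real_smul]
    ring

lemma HasWeakPartial.weakPartial {i : Fin n} {f g : E n → ℂ} (h : HasWeakPartial Ω i f g) :
    HasWeakPartial Ω i f (weakPartial Ω i f) := by
  have h' : ∃ g, HasWeakPartial Ω i f g := ⟨g, h⟩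
  unfold FracElliptic.weakPartial
  rw [dif_pos h']
  exact h'.choose_spec

lemma HasWeakPartial.weakPartial_ae_eq (hΩ : IsOpen Ω) {i : Fin n} {f g : E n → ℂ}
    (h : HasWeakPartial Ω i f g) : FracElliptic.weakPartial Ω i f =ᵐ[volume.restrict Ω] g :=
  h.weakPartial.ae_eq hΩ h

lemma MemSobolev.memL2 {l : ℕ} {f : E n → ℂ} (hf : MemSobolev Ω l f) : MemL2 Ω f := by
  cases l with
  | zero => exact hf
  | succ l => exact hf.1

lemma MemSobolev.memL2_weakPartial (hΩ : IsOpen Ω) {l : ℕ} {f : E n → ℂ}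
    (hf : MemSobolev Ω (l + 1) f) (i : Fin n) : MemL2 Ω (weakPartial Ω i f) := by
  obtain ⟨g, hg, hg2⟩ := hf.2 i
  exact (memLp_congr_ae (hg.weakPartial_ae_eq hΩ)).2 hg2.memL2

lemma MemL2.locallyIntegrableOn (hΩb : Bornology.IsBounded Ω) {f : E n → ℂ} (hf : MemL2 Ω f) :
    LocallyIntegrableOn f Ω := by
  have : IsFiniteMeasure (volume.restrict Ω) := ⟨by simpa using hΩb.measure_lt_top⟩
  exact IntegrableOn.locallyIntegrableOn (hf.integrable (by norm_num))

/-! ### The product rule -/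

lemma MemL2.continuousOn_mul (hΩ : IsOpen Ω) (hΩb : Bornology.IsBounded Ω) {b : E n → ℝ}
    (hb : ContinuousOn b (closure Ω)) {f : E n → ℂ} (hf : MemL2 Ω f) :
    MemL2 Ω fun Q => (b Q : ℂ) * f Q := by
  obtain ⟨C, hC⟩ := (hΩb.isCompact_closure).exists_bound_of_continuousOn hb
  have hbm : AEStronglyMeasurable (fun Q => (b Q : ℂ)) (volume.restrict Ω) :=
    (Complex.continuous_ofReal.comp_continuousOn
      (hb.mono subset_closure)).aestronglyMeasurable hΩ.measurableSet
  refine MemLp.of_le_mul (c := C) hf (hbm.mul hf.1) ?_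
  filter_upwards [ae_restrict_mem hΩ.measurableSet] with Q hQ
  rw [norm_mul, Complex.norm_real]
  exact mul_le_mul_of_nonneg_right (hC Q (subset_closure hQ)) (norm_nonneg _)

/-- The weak derivative of `f` is tested with `b φ`, which extends by zero across the boundary as a
`C^1` function. -/
lemma HasWeakPartial.integral_mul_eq (hΩ : IsOpen Ω) {j : Fin n} {f g : E n → ℂ}
    (h : HasWeakPartial Ω j f g) {b : E n → ℝ} (hb : ContDiffOn ℝ 1 b Ω) {φ : E n → ℂ}
    (hφ : IsTestFunction Ω φ) :
    ∫ Q in Ω, f Q * ((fderiv ℝ b Q (EuclideanSpace.single j 1) : ℂ) * φ Q +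
        (b Q : ℂ) * partialDeriv j φ Q) = -∫ Q in Ω, g Q * ((b Q : ℂ) * φ Q) := by
  set ψ : E n → ℂ := fun Q => (b Q : ℂ) * φ Q with hψ
  have hs : tsupport ψ ⊆ tsupport φ := tsupport_mul_subset_right
  have hbd : ∀ Q ∈ Ω, ContDiffAt ℝ 1 b Q := fun Q hQ => hb.contDiffAt (hΩ.mem_nhds hQ)
  have hψ1 : ContDiff ℝ 1 ψ := by
    refine contDiff_iff_contDiffAt.2 fun Q => ?_
    by_cases hQ : Q ∈ tsupport ψ
    · exact (Complex.ofRealCLM.contDiff.contDiffAt.comp Q (hbd Q (hφ.2.2 (hs hQ)))).mul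
        (hφ.1.contDiffAt.of_le (by norm_num))
    · exact contDiffAt_const.congr_of_eventuallyEq (notMem_tsupport_iff_eventuallyEq.1 hQ)
  have := h.integral_eq_of_contDiff_one hΩ hψ1
    (hφ.2.1.of_isClosed_subset (isClosed_tsupport _) hs) (hs.trans hφ.2.2)
  rw [← this]
  refine setIntegral_congr_fun hΩ.measurableSet fun Q hQ => ?_
  have hd1 : HasFDerivAt (fun Q => (b Q : ℂ)) (Complex.ofRealCLM ∘L fderiv ℝ b Q) Q :=
    Complex.ofRealCLM.hasFDerivAt.comp Q ((hbd Q hQ).differentiableAt (by norm_num)).hasFDerivAt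
  have hd2 : HasFDerivAt φ (fderiv ℝ φ Q) Q :=
    (hφ.1.differentiable (by norm_num) Q).hasFDerivAt
  have hd3 : fderiv ℝ ψ Q = _ := (hd1.mul hd2).fderiv
  simp only [partialDeriv, hd3]
  refine congrArg (f Q * ·) ?_
  simp
  ring

end weak


section forms

variable {n : ℕ} {Ω : Set (E n)}

/-! ### The inner product and the norm of `L_2` -/

lemma normL2_eq_toReal {f : E n → ℂ} (hf : AEStronglyMeasurable f (volume.restrict Ω)) :
    normL2 Ω f = (eLpNorm f 2 (volume.restrict Ω)).toReal := by
  have h : ∫ Q in Ω, ‖f Q‖ ^ 2 = (eLpNorm f 2 (volume.restrict Ω)).toReal ^ 2 := by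
    rw [integral_eq_lintegral_of_nonneg_ae (f := fun Q => ‖f Q‖ ^ 2) (Eventually.of_forall fun _ => by positivity)
      (hf.norm.pow 2), ← ENNReal.toReal_pow, eLpNorm_two_sq]
    congr 1
    refine lintegral_congr fun Q => ?_
    rw [ENNReal.ofReal_pow (norm_nonneg _), ofReal_norm]
  rw [normL2, h, Real.sqrt_sq ENNReal.toReal_nonneg]

lemma enorm_innerL2_le {f g : E n → ℂ} (hf : AEStronglyMeasurable f (volume.restrict Ω))
    (hg : AEStronglyMeasurable g (volume.restrict Ω)) :
    ‖innerL2 Ω f g‖ₑ ≤ eLpNorm f 2 (volume.restrict Ω) * eLpNorm g 2 (volume.restrict Ω) := by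
  refine (ENNReal.pow_le_pow_left_iff two_ne_zero).1 ?_
  rw [mul_pow, eLpNorm_two_sq, eLpNorm_two_sq]
  refine le_trans (pow_le_pow_left' (enorm_integral_le_lintegral_enorm _) 2)
    (le_trans (le_of_eq ?_) (lintegral_mul_sq_le _ hf.enorm hg.enorm))
  simp only [enorm_mul, RCLike.enorm_conj]

lemma norm_innerL2_le {f g : E n → ℂ} (hf : MemL2 Ω f) (hg : MemL2 Ω g) :
    ‖innerL2 Ω f g‖ ≤ normL2 Ω f * normL2 Ω g := by
  rw [normL2_eq_toReal hf.1, normL2_eq_toReal hg.1, ← ENNReal.toReal_mul, ← toReal_enorm]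
  exact ENNReal.toReal_mono (ENNReal.mul_ne_top hf.2.ne hg.2.ne) (enorm_innerL2_le hf.1 hg.1)

lemma MemL2.conj {f : E n → ℂ} (hf : MemL2 Ω f) :
    MemL2 Ω fun Q => (starRingEnd ℂ) (f Q) :=
  hf.star

lemma MemL2.integrable_mul_conj {f g : E n → ℂ} (hf : MemL2 Ω f) (hg : MemL2 Ω g) :
    Integrable (fun Q => f Q * (starRingEnd ℂ) (g Q)) (volume.restrict Ω) :=
  MemLp.integrable_mul (p := 2) (q := 2) hf hg.conj

lemma innerL2_conj (f g : E n → ℂ) : innerL2 Ω f g = (starRingEnd ℂ) (innerL2 Ω g f) := by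
  unfold innerL2
  rw [← integral_conj]
  simp [mul_comm]

lemma tendsto_innerL2 {v f : E n → ℂ} {φ : ℕ → E n → ℂ} (hv : MemL2 Ω v) (hf : MemL2 Ω f)
    (hφ : ∀ k, MemL2 Ω (φ k))
    (h : Tendsto (fun k => eLpNorm (f - φ k) 2 (volume.restrict Ω)) atTop (𝓝 0)) :
    Tendsto (fun k => innerL2 Ω v (φ k)) atTop (𝓝 (innerL2 Ω v f)) := by
  refine tendsto_iff_norm_sub_tendsto_zero.2 ?_
  have h2 : Tendsto (fun k => normL2 Ω v * normL2 Ω (f - φ k)) atTop (𝓝 0) := by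
    have := ((ENNReal.tendsto_toReal ENNReal.zero_ne_top).comp h).const_mul (normL2 Ω v)
    rw [ENNReal.toReal_zero, mul_zero] at this
    refine this.congr fun k => ?_
    rw [normL2_eq_toReal (hf.1.sub (hφ k).1)]
    rfl
  refine squeeze_zero (fun _ => norm_nonneg _) (fun k => ?_) h2
  refine le_trans (le_of_eq ?_) (norm_innerL2_le hv (hf.sub (hφ k)))
  rw [← norm_neg, neg_sub]
  congr 1
  unfold innerL2
  rw [← integral_sub (hv.integrable_mul_conj hf) (hv.integrable_mul_conj (hφ k))]
  simp [mul_sub]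

lemma normH10_sq {f : E n → ℂ} :
    normH10 Ω f ^ 2 = ∑ i, ∫ Q in Ω, ‖weakPartial Ω i f Q‖ ^ 2 :=
  Real.sq_sqrt (Finset.sum_nonneg fun _ _ => integral_nonneg fun _ => by positivity)

lemma energy_eq_ofReal {f : E n → ℂ} (hf : ∀ i, MemL2 Ω (weakPartial Ω i f)) :
    energy Ω f = ENNReal.ofReal (normH10 Ω f ^ 2) := by
  rw [normH10_sq, ENNReal.ofReal_sum_of_nonneg fun _ _ => integral_nonneg fun _ => by positivity]
  refine Finset.sum_congr rfl fun i _ => ?_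
  rw [← Real.sq_sqrt (integral_nonneg fun _ => by positivity :
      0 ≤ ∫ Q in Ω, ‖weakPartial Ω i f Q‖ ^ 2), ← normL2, normL2_eq_toReal (hf i).1,
    ENNReal.ofReal_pow ENNReal.toReal_nonneg, ENNReal.ofReal_toReal (hf i).2.ne]

/-! ### Integration by parts -/

lemma partialDeriv_conj {φ : E n → ℂ} (hφ : ContDiff ℝ ∞ φ) (j : Fin n) (Q : E n) :
    partialDeriv j (fun Q => (starRingEnd ℂ) (φ Q)) Q = (starRingEnd ℂ) (partialDeriv j φ Q) := by
  have h := Complex.conjCLE.toContinuousLinearMap.hasFDerivAt.comp Q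
    (hφ.differentiable (by norm_num) Q).hasFDerivAt
  have h2 : fderiv ℝ (fun Q => (starRingEnd ℂ) (φ Q)) Q = _ := h.fderiv
  simp [partialDeriv, h2]

lemma IsTestFunction.conj {φ : E n → ℂ} (hφ : IsTestFunction Ω φ) :
    IsTestFunction Ω fun Q => (starRingEnd ℂ) (φ Q) := by
  have hs : tsupport (fun Q => (starRingEnd ℂ) (φ Q)) ⊆ tsupport φ :=
    closure_mono fun Q hQ h => hQ (by simp [h])
  exact ⟨Complex.conjCLE.contDiff.comp hφ.1,
    hφ.2.1.of_isClosed_subset (isClosed_tsupport _) hs, hs.trans hφ.2.2⟩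

/-- The definition of the weak derivative, applied to conjugates of test functions tending to `f`.
Vanishing of `f` on the boundary is encoded in this approximation, so no boundary term appears. -/
lemma HasWeakPartial.innerL2_eq_neg (hΩ : IsOpen Ω) {j : Fin n} {w v f : E n → ℂ}
    (h : HasWeakPartial Ω j w v) (hw : MemL2 Ω w) (hv : MemL2 Ω v) (hf : MemH10 Ω f) :
    innerL2 Ω v f = -innerL2 Ω w (FracElliptic.weakPartial Ω j f) := by
  have hfj := hf.1.memL2_weakPartial hΩ j
  obtain ⟨hf1, φ, hφ, h0, h1⟩ := hf
  have t1 := tendsto_innerL2 hv hf1.memL2 (fun k => (hφ k).memLp) h0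
  have t2 := (tendsto_innerL2 hw hfj (fun k => (hφ k).memLp_partialDeriv j) (h1 j)).neg
  refine tendsto_nhds_unique t1 (t2.congr fun k => ?_)
  have := h.2.2 _ (hφ k).conj
  simp only [partialDeriv_conj (hφ k).1] at this
  simp only [innerL2, this, neg_neg]

/-! ### The second order part -/

variable {A : Fin n → Fin n → E n → ℝ}

/-- The `j`-th component of the flux `∑ i, a^{ij} D_i f`. -/
noncomputable def flux (Ω : Set (E n)) (A : Fin n → Fin n → E n → ℝ) (f : E n → ℂ) (j : Fin n)
    (Q : E n) : ℂ :=
  ∑ i, (A i j Q : ℂ) * weakPartial Ω i f Q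

lemma memL2_flux (hΩ : IsOpen Ω) (hΩb : Bornology.IsBounded Ω)
    (hA : ∀ i j, IsC1Closure Ω (A i j)) {f : E n → ℂ} (hf : ∀ i, MemL2 Ω (weakPartial Ω i f))
    (j : Fin n) : MemL2 Ω (flux Ω A f j) :=
  memLp_finsetSum _ fun i _ => (hf i).continuousOn_mul hΩ hΩb (hA i j).1

lemma exists_hasWeakPartial_flux (hΩ : IsOpen Ω) (hΩb : Bornology.IsBounded Ω)
    (hA : ∀ i j, IsC1Closure Ω (A i j)) {f : E n → ℂ} (hf : MemSobolev Ω 2 f) (j : Fin n) :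
    ∃ v, HasWeakPartial Ω j (flux Ω A f j) v ∧ MemL2 Ω v := by
  have hf1 : ∀ i, ∃ h, HasWeakPartial Ω j (weakPartial Ω i f) h ∧ MemL2 Ω h := by
    intro i
    obtain ⟨g, hg, hg2⟩ := hf.2 i
    obtain ⟨h, hh, hh2⟩ := hg2.2 j
    have hae := hg.weakPartial_ae_eq hΩ
    refine ⟨h, ⟨hg.weakPartial.2.1, hh.2.1, fun φ hφ => ?_⟩, hh2⟩
    rw [← hh.2.2 φ hφ]
    refine integral_congr_ae ?_
    filter_upwards [hae] with Q hQ
    rw [hQ]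
  choose h hh hhL using hf1
  have hfL := fun i => hf.memL2_weakPartial hΩ i
  have hdL : ∀ i, MemL2 Ω fun Q =>
      (fderiv ℝ (A i j) Q (EuclideanSpace.single j 1) : ℂ) * weakPartial Ω i f Q := by
    intro i
    -- The extension of the derivative to the compact closure makes it bounded, hence an `L_2`
    -- multiplier.
    obtain ⟨G, hG, hGA⟩ := (hA i j).2.2
    have hGc : ContinuousOn (fun Q => G Q (EuclideanSpace.single j 1)) (closure Ω) :=
      hG.clm_apply continuousOn_const
    refine (memLp_congr_ae ?_).2 ((hfL i).continuousOn_mul hΩ hΩb hGc)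
    filter_upwards [ae_restrict_mem hΩ.measurableSet] with Q hQ
    rw [hGA hQ]
  have hAL : ∀ {u : E n → ℂ}, MemL2 Ω u → ∀ i, MemL2 Ω fun Q => (A i j Q : ℂ) * u Q :=
    fun hu i => hu.continuousOn_mul hΩ hΩb (hA i j).1
  set v : E n → ℂ := fun Q => ∑ i,
    ((fderiv ℝ (A i j) Q (EuclideanSpace.single j 1) : ℂ) * weakPartial Ω i f Q +
      (A i j Q : ℂ) * h i Q) with hv
  have hvL : MemL2 Ω v := memLp_finsetSum _ fun i _ => (hdL i).add (hAL (hhL i) i)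
  refine ⟨v, ⟨(memL2_flux hΩ hΩb hA hfL j).locallyIntegrableOn hΩb,
    hvL.locallyIntegrableOn hΩb, fun φ hφ => ?_⟩, hvL⟩
  have i1 : ∀ {u χ : E n → ℂ}, MemL2 Ω u → MemL2 Ω χ →
      Integrable (fun Q => u Q * χ Q) (volume.restrict Ω) :=
    fun hu hχ => MemLp.integrable_mul (p := 2) (q := 2) hu hχ
  have hpd : MemL2 Ω (partialDeriv j φ) := hφ.memLp_partialDeriv j
  have hφL : MemL2 Ω φ := hφ.memLp
  have i2 : ∀ i, Integrable (fun Q => ((fderiv ℝ (A i j) Q (EuclideanSpace.single j 1) : ℂ) *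
      weakPartial Ω i f Q + (A i j Q : ℂ) * h i Q) * φ Q) (volume.restrict Ω) :=
    fun i => i1 ((hdL i).add (hAL (hhL i) i)) hφL
  simp only [flux, hv, Finset.sum_mul]
  rw [integral_finsetSum _ fun i _ => i1 (hAL (hfL i) i) hpd,
    integral_finsetSum _ fun i _ => i2 i,
    ← Finset.sum_neg_distrib]
  refine Finset.sum_congr rfl fun i _ => ?_
  have key := (hh i).integral_mul_eq hΩ (hA i j).2.1 hφ
  have e1 : ∫ Q in Ω, weakPartial Ω i f Q *
      ((fderiv ℝ (A i j) Q (EuclideanSpace.single j 1) : ℂ) * φ Q +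
        (A i j Q : ℂ) * partialDeriv j φ Q) =
      (∫ Q in Ω, ((fderiv ℝ (A i j) Q (EuclideanSpace.single j 1) : ℂ) *
        weakPartial Ω i f Q) * φ Q) +
      ∫ Q in Ω, ((A i j Q : ℂ) * weakPartial Ω i f Q) * partialDeriv j φ Q := by
    rw [← integral_add (i1 (hdL i) hφL) (i1 (hAL (hfL i) i) hpd)]
    exact integral_congr_ae (Eventually.of_forall fun Q => by simp only; ring)
  have e2 : ∫ Q in Ω, ((fderiv ℝ (A i j) Q (EuclideanSpace.single j 1) : ℂ) *
        weakPartial Ω i f Q + (A i j Q : ℂ) * h i Q) * φ Q =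
      (∫ Q in Ω, ((fderiv ℝ (A i j) Q (EuclideanSpace.single j 1) : ℂ) *
        weakPartial Ω i f Q) * φ Q) + ∫ Q in Ω, ((A i j Q : ℂ) * h i Q) * φ Q := by
    rw [← integral_add (i1 (hdL i) hφL) (i1 (hAL (hhL i) i) hφL)]
    exact integral_congr_ae (Eventually.of_forall fun Q => by simp only; ring)
  have e3 : ∫ Q in Ω, h i Q * ((A i j Q : ℂ) * φ Q) =
      ∫ Q in Ω, ((A i j Q : ℂ) * h i Q) * φ Q :=
    integral_congr_ae (Eventually.of_forall fun Q => by simp only; ring)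
  rw [e1, e3] at key
  rw [e2]
  linear_combination key

lemma memL2_weakPartial_flux (hΩ : IsOpen Ω) (hΩb : Bornology.IsBounded Ω)
    (hA : ∀ i j, IsC1Closure Ω (A i j)) {f : E n → ℂ} (hf : MemSobolev Ω 2 f) (j : Fin n) :
    MemL2 Ω (weakPartial Ω j (flux Ω A f j)) := by
  obtain ⟨v, hv, hv2⟩ := exists_hasWeakPartial_flux hΩ hΩb hA hf j
  exact (memLp_congr_ae (hv.weakPartial_ae_eq hΩ)).2 hv2

/-- The density of the quadratic form of the second order part. -/
noncomputable def formDensity (Ω : Set (E n)) (A : Fin n → Fin n → E n → ℝ) (f : E n → ℂ)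
    (Q : E n) : ℂ :=
  ∑ j, flux Ω A f j Q * (starRingEnd ℂ) (weakPartial Ω j f Q)

lemma integrable_formDensity (hΩ : IsOpen Ω) (hΩb : Bornology.IsBounded Ω)
    (hA : ∀ i j, IsC1Closure Ω (A i j)) {f : E n → ℂ} (hf : ∀ i, MemL2 Ω (weakPartial Ω i f)) :
    Integrable (formDensity Ω A f) (volume.restrict Ω) :=
  integrable_finsetSum _ fun j _ => (memL2_flux hΩ hΩb hA hf j).integrable_mul_conj (hf j)

lemma innerL2_opL (hΩ : IsOpen Ω) (hΩb : Bornology.IsBounded Ω)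
    (hA : ∀ i j, IsC1Closure Ω (A i j)) {P : E n} {α : ℝ} {ρ : E n → ℝ} {f : E n → ℂ}
    (hf : f ∈ domL Ω) (hk : MemL2 Ω fun Q => (ρ Q : ℂ) * kipriyanov P α f Q) :
    innerL2 Ω (opL Ω P α A ρ f) f = (∫ Q in Ω, formDensity Ω A f Q) +
      innerL2 Ω (fun Q => (ρ Q : ℂ) * kipriyanov P α f Q) f := by
  have hfL : MemL2 Ω f := hf.1.memL2
  have hdL := fun i => hf.1.memL2_weakPartial hΩ i
  have hvL := fun j => memL2_weakPartial_flux hΩ hΩb hA hf.1 j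
  have e1 : ∀ j, innerL2 Ω (weakPartial Ω j (flux Ω A f j)) f =
      -innerL2 Ω (flux Ω A f j) (weakPartial Ω j f) := by
    intro j
    obtain ⟨v, hv, -⟩ := exists_hasWeakPartial_flux hΩ hΩb hA hf.1 j
    exact hv.weakPartial.innerL2_eq_neg hΩ (memL2_flux hΩ hΩb hA hdL j) (hvL j) hf.2
  have e2 : ∫ Q in Ω, formDensity Ω A f Q =
      -∑ j, innerL2 Ω (weakPartial Ω j (flux Ω A f j)) f := by
    simp only [formDensity]
    rw [integral_finsetSum _ fun j _ =>
      (memL2_flux hΩ hΩb hA hdL j).integrable_mul_conj (hdL j), ← Finset.sum_neg_distrib]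
    exact Finset.sum_congr rfl fun j _ => by rw [e1, neg_neg, innerL2]
  rw [e2]
  have i1 : Integrable (fun Q => -∑ j, weakPartial Ω j (flux Ω A f j) Q * (starRingEnd ℂ) (f Q))
      (volume.restrict Ω) :=
    (integrable_finsetSum _ fun j _ => (hvL j).integrable_mul_conj hfL).neg
  unfold innerL2
  rw [← integral_finsetSum _ fun j _ => (hvL j).integrable_mul_conj hfL, ← integral_neg,
    ← integral_add i1 (hk.integrable_mul_conj hfL)]
  refine integral_congr_ae (Eventually.of_forall fun Q => ?_)
  change (-(∑ j, weakPartial Ω j (flux Ω A f j) Q) + (ρ Q : ℂ) * kipriyanov P α f Q) *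
    (starRingEnd ℂ) (f Q) = _
  simp only [add_mul, neg_mul, Finset.sum_mul]

/-- The mixed products of real and imaginary parts of `z` contribute only to the imaginary part of
the form. The real part is therefore the sum of two real forms, and no symmetry of `B` is required.
-/
lemma form_re_ge {B : Fin n → Fin n → ℝ} {a : ℝ}
    (hB : ∀ v : Fin n → ℝ, a * ∑ i, v i ^ 2 ≤ ∑ i, ∑ j, B i j * v i * v j) (z : Fin n → ℂ) :
    a * ∑ i, ‖z i‖ ^ 2 ≤
      (∑ j, (∑ i, (B i j : ℂ) * z i) * (starRingEnd ℂ) (z j)).re := by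
  have h1 := hB fun i => (z i).re
  have h2 := hB fun i => (z i).im
  have e : (∑ j, (∑ i, (B i j : ℂ) * z i) * (starRingEnd ℂ) (z j)).re =
      (∑ i, ∑ j, B i j * (z i).re * (z j).re) + ∑ i, ∑ j, B i j * (z i).im * (z j).im := by
    simp_rw [Finset.sum_mul]
    rw [Finset.sum_comm, ← Finset.sum_add_distrib, Complex.re_sum]
    refine Finset.sum_congr rfl fun i _ => ?_
    rw [← Finset.sum_add_distrib, Complex.re_sum]
    refine Finset.sum_congr rfl fun j _ => ?_
    simp
  have e2 : ∑ i, ‖z i‖ ^ 2 = (∑ i, (z i).re ^ 2) + ∑ i, (z i).im ^ 2 := by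
    rw [← Finset.sum_add_distrib]
    refine Finset.sum_congr rfl fun i _ => ?_
    rw [← Complex.normSq_eq_norm_sq, Complex.normSq_apply]
    ring
  rw [e, e2, mul_add]
  exact add_le_add h1 h2

/-- Cauchy–Schwarz over the pairs `(i, j)`, whence the Euclidean matrix norm. -/
lemma norm_form_le (B : Fin n → Fin n → ℝ) (z : Fin n → ℂ) :
    ‖∑ j, (∑ i, (B i j : ℂ) * z i) * (starRingEnd ℂ) (z j)‖ ≤
      Real.sqrt (∑ i, ∑ j, |B i j| ^ 2) * ∑ i, ‖z i‖ ^ 2 := by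
  have h := Real.sum_mul_le_sqrt_mul_sqrt (Finset.univ : Finset (Fin n × Fin n))
    (fun p => |B p.1 p.2|) (fun p => ‖z p.1‖ * ‖z p.2‖)
  have e : ∑ p : Fin n × Fin n, (‖z p.1‖ * ‖z p.2‖) ^ 2 = (∑ i, ‖z i‖ ^ 2) ^ 2 := by
    rw [Fintype.sum_prod_type, sq, Finset.sum_mul_sum]
    simp only [mul_pow]
  rw [e, Real.sqrt_sq (Finset.sum_nonneg fun _ _ => by positivity)] at h
  simp only [Fintype.sum_prod_type] at h
  refine le_trans ?_ h
  simp_rw [Finset.sum_mul]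
  rw [Finset.sum_comm]
  refine (norm_sum_le _ _).trans (Finset.sum_le_sum fun i _ => ?_)
  refine (norm_sum_le _ _).trans (Finset.sum_le_sum fun j _ => ?_)
  rw [norm_mul, norm_mul, RCLike.norm_conj, Complex.norm_real, Real.norm_eq_abs, mul_assoc]

/-- Without boundedness the real `sSup` would take its default value `0` and dominate nothing. -/
lemma bddAbove_coeff (hΩb : Bornology.IsBounded Ω) (hA : ∀ i j, IsC1Closure Ω (A i j)) :
    BddAbove ((fun Q => Real.sqrt (∑ i : Fin n, ∑ j : Fin n, |A i j Q| ^ 2)) '' Ω) := by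
  have hc : ContinuousOn (fun Q => Real.sqrt (∑ i : Fin n, ∑ j : Fin n, |A i j Q| ^ 2))
      (closure Ω) := by
    refine Real.continuous_sqrt.comp_continuousOn (continuousOn_finsetSum _ fun i _ =>
      continuousOn_finsetSum _ fun j _ => ((hA i j).1.abs.pow 2))
  exact (hΩb.isCompact_closure.bddAbove_image hc).mono (Set.image_mono subset_closure)

lemma coeffSup_nonneg : 0 ≤ coeffSup Ω A :=
  Real.sSup_nonneg fun _ ⟨_, _, h⟩ => h ▸ Real.sqrt_nonneg _

lemma integrable_sum_norm_sq {f : E n → ℂ} (hf : ∀ i, MemL2 Ω (weakPartial Ω i f)) :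
    Integrable (fun Q => ∑ i, ‖weakPartial Ω i f Q‖ ^ 2) (volume.restrict Ω) :=
  integrable_finsetSum _ fun i _ => (hf i).integrable_norm_pow two_ne_zero

lemma integral_sum_norm_sq {f : E n → ℂ} (hf : ∀ i, MemL2 Ω (weakPartial Ω i f)) :
    ∫ Q in Ω, ∑ i, ‖weakPartial Ω i f Q‖ ^ 2 = normH10 Ω f ^ 2 := by
  rw [normH10_sq, integral_finsetSum _ fun i _ => (hf i).integrable_norm_pow two_ne_zero]

lemma re_integral_formDensity_ge (hΩ : IsOpen Ω) (hΩb : Bornology.IsBounded Ω)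
    (hA : ∀ i j, IsC1Closure Ω (A i j)) {a : ℝ}
    (hell : ∀ Q ∈ Ω, ∀ v : Fin n → ℝ, a * ∑ i, v i ^ 2 ≤ ∑ i, ∑ j, A i j Q * v i * v j)
    {f : E n → ℂ} (hf : ∀ i, MemL2 Ω (weakPartial Ω i f)) :
    a * normH10 Ω f ^ 2 ≤ (∫ Q in Ω, formDensity Ω A f Q).re := by
  have hi := integrable_formDensity hΩ hΩb hA hf
  have hre : (∫ Q in Ω, formDensity Ω A f Q).re = ∫ Q in Ω, (formDensity Ω A f Q).re :=
    (integral_re hi).symm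
  rw [hre, ← integral_sum_norm_sq hf, ← integral_const_mul]
  refine setIntegral_mono_on ((integrable_sum_norm_sq hf).const_mul a) hi.re hΩ.measurableSet
    fun Q hQ => ?_
  exact form_re_ge (hell Q hQ) _

lemma norm_integral_formDensity_le (hΩ : IsOpen Ω) (hΩb : Bornology.IsBounded Ω)
    (hA : ∀ i j, IsC1Closure Ω (A i j)) {f : E n → ℂ} (hf : ∀ i, MemL2 Ω (weakPartial Ω i f)) :
    ‖∫ Q in Ω, formDensity Ω A f Q‖ ≤ coeffSup Ω A * normH10 Ω f ^ 2 := by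
  rw [← integral_sum_norm_sq hf, ← integral_const_mul]
  refine norm_integral_le_of_norm_le ((integrable_sum_norm_sq hf).const_mul _) ?_
  filter_upwards [ae_restrict_mem hΩ.measurableSet] with Q hQ
  refine (norm_form_le (fun i j => A i j Q) _).trans ?_
  exact mul_le_mul_of_nonneg_right
    (le_csSup (bddAbove_coeff hΩb hA) (Set.mem_image_of_mem _ hQ))
    (Finset.sum_nonneg fun _ _ => by positivity)

end forms


/-! ### The constants -/

lemma abs_arg_le_arctan {w : ℂ} {t : ℝ} (hre : 0 < w.re) (him : |w.im| ≤ t * w.re) :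
    |Complex.arg w| ≤ Real.arctan t := by
  have h0 := abs_lt.1 (Complex.abs_arg_lt_pi_div_two_iff.2 (Or.inl hre))
  have h1 : Complex.arg w = Real.arctan (w.im / w.re) := by
    rw [← Complex.tan_arg, Real.arctan_tan h0.1 h0.2]
  have h2 : |w.im / w.re| ≤ t := by
    rw [abs_div, abs_of_pos hre, div_le_iff₀ hre]
    exact him
  rw [h1, abs_le, ← Real.arctan_neg]
  exact ⟨Real.arctan_strictMono.monotone (abs_le.1 h2).1,
    Real.arctan_strictMono.monotone (abs_le.1 h2).2⟩

lemma mem_sector {a 𝒜 ℐ η ε N x y : ℝ} (ha : 0 < a) (h𝒜 : 0 ≤ 𝒜) (hℐ : 0 < ℐ) (hε : 0 < ε)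
    {z : ℂ} (hz : z = (x : ℂ) + y * Complex.I) (hx : a * N ^ 2 + (η ^ 2)⁻¹ ≤ x)
    (hy : |y| ≤ 𝒜 * N ^ 2 + ℐ * N) :
    z ∈ sector (vertex a 𝒜 ℐ η ε : ℂ) (semiAngle a 𝒜 ℐ ε) := by
  refine ⟨?_, Real.arctan_lt_pi_div_two _⟩
  have hre : (z - (vertex a 𝒜 ℐ η ε : ℂ)).re = x - vertex a 𝒜 ℐ η ε := by simp [hz]
  have him : (z - (vertex a 𝒜 ℐ η ε : ℂ)).im = y := by simp [hz]
  have hq : a * (ℐ / 2) * (ℐ / 2 * ε ^ 2 + 𝒜 * ε)⁻¹ =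
      a * (ℐ / (2 * ε)) / (ℐ / 2 * ε + 𝒜) := by
    have : 0 < ℐ / 2 * ε + 𝒜 := by positivity
    have : 0 < ℐ / 2 * ε ^ 2 + 𝒜 * ε := by positivity
    field_simp
  have hlow : a * N ^ 2 + a * (ℐ / (2 * ε)) / (ℐ / 2 * ε + 𝒜) ≤ x - vertex a 𝒜 ℐ η ε := by
    rw [vertex, hq]
    linarith
  -- Strict positivity holds even for `N = 0`; it places `z - γ` in the open right half-plane, where
  -- the argument is an arctangent.
  have hpos : 0 < a * N ^ 2 + a * (ℐ / (2 * ε)) / (ℐ / 2 * ε + 𝒜) := by positivity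
  refine abs_arg_le_arctan (by rw [hre]; linarith) ?_
  rw [hre, him]
  have ht : 0 ≤ ℐ / (2 * a) * ε + 𝒜 / a := by positivity
  have hyoung : ℐ * N ≤ ℐ / 2 * ε * N ^ 2 + ℐ / (2 * ε) := by
    have e : ℐ / 2 * ε * N ^ 2 + ℐ / (2 * ε) - ℐ * N = ℐ / (2 * ε) * (ε * N - 1) ^ 2 := by
      field_simp
      ring
    have : 0 ≤ ℐ / (2 * ε) * (ε * N - 1) ^ 2 := by positivity
    linarith
  calc |y| ≤ 𝒜 * N ^ 2 + (ℐ / 2 * ε * N ^ 2 + ℐ / (2 * ε)) := by linarith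
    _ = (ℐ / (2 * a) * ε + 𝒜 / a) *
        (a * N ^ 2 + a * (ℐ / (2 * ε)) / (ℐ / 2 * ε + 𝒜)) := by
      have : 0 < ℐ / 2 * ε + 𝒜 := by positivity
      field_simp
      ring
    _ ≤ _ := mul_le_mul_of_nonneg_left hlow ht

section vertex

variable {a 𝒜 ℐ η : ℝ}

/-- With `q = ε² + 2(𝒜/ℐ)ε` the vertex equals `(q - aη²) / (η² q)`, and `ξ` is the positive root of
`q = aη²`. The cofactor of `ε - ξ` is positive, so sign and zero of `γ` can be read off. -/
lemma vertex_eq (ha : 0 < a) (h𝒜 : 0 ≤ 𝒜) (hℐ : 0 < ℐ) (hη : η ≠ 0) {ε : ℝ} (hε : 0 < ε) :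
    vertex a 𝒜 ℐ η ε = (ε - xi a 𝒜 ℐ η) *
      ((ε + 𝒜 / ℐ + Real.sqrt ((𝒜 / ℐ) ^ 2 + a * η ^ 2)) /
        (η ^ 2 * (ε ^ 2 + 2 * (𝒜 / ℐ) * ε))) := by
  have hη2 : 0 < η ^ 2 := by positivity
  have hs := Real.sq_sqrt (show 0 ≤ (𝒜 / ℐ) ^ 2 + a * η ^ 2 by positivity)
  set R := Real.sqrt ((𝒜 / ℐ) ^ 2 + a * η ^ 2)
  have h1 : (ε - xi a 𝒜 ℐ η) * (ε + 𝒜 / ℐ + R) = ε ^ 2 + 2 * (𝒜 / ℐ) * ε - a * η ^ 2 := by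
    change (ε - (R - 𝒜 / ℐ)) * _ = _
    linear_combination -hs
  have h2 : 0 < ε ^ 2 + 2 * (𝒜 / ℐ) * ε := by positivity
  have h3 : ℐ / 2 * ε ^ 2 + 𝒜 * ε = ℐ / 2 * (ε ^ 2 + 2 * (𝒜 / ℐ) * ε) := by field_simp
  rw [mul_div_assoc', h1, vertex, h3]
  generalize ε ^ 2 + 2 * (𝒜 / ℐ) * ε = q at h2
  field_simp

lemma vertex_factor_pos (ha : 0 < a) (h𝒜 : 0 ≤ 𝒜) (hℐ : 0 < ℐ) (hη : η ≠ 0) {ε : ℝ}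
    (hε : 0 < ε) :
    0 < (ε + 𝒜 / ℐ + Real.sqrt ((𝒜 / ℐ) ^ 2 + a * η ^ 2)) /
        (η ^ 2 * (ε ^ 2 + 2 * (𝒜 / ℐ) * ε)) := by
  positivity

lemma xi_pos (ha : 0 < a) (hη : η ≠ 0) : 0 < xi a 𝒜 ℐ η := by
  have : 0 < a * η ^ 2 := by positivity
  refine sub_pos.2 (Real.lt_sqrt_of_sq_lt ?_)
  linarith

lemma semiAngle_xi (ha : 0 < a) (hℐ : 0 < ℐ) :
    semiAngle a 𝒜 ℐ (xi a 𝒜 ℐ η) =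
      Real.arctan (Real.sqrt ((𝒜 / (2 * a)) ^ 2 + ℐ ^ 2 * η ^ 2 / (4 * a)) + 𝒜 / (2 * a)) := by
  have h : Real.sqrt ((𝒜 / (2 * a)) ^ 2 + ℐ ^ 2 * η ^ 2 / (4 * a)) =
      ℐ / (2 * a) * Real.sqrt ((𝒜 / ℐ) ^ 2 + a * η ^ 2) := by
    rw [← Real.sqrt_sq (show 0 ≤ ℐ / (2 * a) by positivity), ← Real.sqrt_mul (by positivity)]
    congr 1
    field_simp
    ring
  rw [semiAngle, xi, h]
  congr 1
  field_simp
  ring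

end vertex

/-! ### The fractional term -/

section fractional

variable {n : ℕ} {Ω : Set (E n)} {P : E n} {α : ℝ}

lemma MemH10.memL2_weakPartial (hΩ : IsOpen Ω) {f : E n → ℂ} (hf : MemH10 Ω f) (i : Fin n) :
    MemL2 Ω (weakPartial Ω i f) :=
  hf.1.memL2_weakPartial hΩ i

lemma exists_pos_isKipriyanovBound (hn : 0 < n) (hΩo : IsOpen Ω) (hΩc : Convex ℝ Ω)
    (hΩb : Bornology.IsBounded Ω) (hP : P ∈ frontier Ω) (hα : 0 < α) (hα1 : α < 1) :
    ∃ K : ℝ, 0 < K ∧ IsKipriyanovBound Ω P α K := by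
  obtain ⟨C, hC, h⟩ := exists_eLpNorm_kipriyanov_sq_le hn hΩo hΩc hΩb hP hα hα1
  -- The added `1` makes the constant positive even if `C = 0`.
  refine ⟨Real.sqrt C.toReal + 1, by positivity, fun f hf => ?_⟩
  obtain ⟨hm, hb⟩ := h f hf
  rw [energy_eq_ofReal (hf.memL2_weakPartial hΩo)] at hb
  have hfin : C * ENNReal.ofReal (normH10 Ω f ^ 2) ≠ ⊤ :=
    ENNReal.mul_ne_top hC ENNReal.ofReal_ne_top
  have hN : 0 ≤ normH10 Ω f := Real.sqrt_nonneg _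
  refine ⟨⟨hm, lt_top_iff_ne_top.2 fun ht => hfin (top_le_iff.1 ?_)⟩, ?_⟩
  · rw [ht] at hb
    simpa using hb
  · rw [normL2_eq_toReal hm]
    have h2 := ENNReal.toReal_mono hfin hb
    rw [ENNReal.toReal_pow, ENNReal.toReal_mul, ENNReal.toReal_ofReal (by positivity)] at h2
    calc _ ≤ Real.sqrt (C.toReal * normH10 Ω f ^ 2) := Real.le_sqrt_of_sq_le h2
      _ = Real.sqrt C.toReal * normH10 Ω f := by
        rw [Real.sqrt_mul ENNReal.toReal_nonneg, Real.sqrt_sq hN]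
      _ ≤ _ := mul_le_mul_of_nonneg_right (by linarith) hN

lemma MemL2.normL2_mul_le (hΩo : IsOpen Ω) {ρ : E n → ℝ} (hρc : ContinuousOn ρ (closure Ω))
    {ρ₁ : ℝ} (hρ₁ : 0 ≤ ρ₁) (hρ : ∀ Q ∈ Ω, |ρ Q| ≤ ρ₁) {g : E n → ℂ} (hg : MemL2 Ω g) :
    MemL2 Ω (fun Q => (ρ Q : ℂ) * g Q) ∧
      normL2 Ω (fun Q => (ρ Q : ℂ) * g Q) ≤ ρ₁ * normL2 Ω g := by
  have hm : AEStronglyMeasurable (fun Q => (ρ Q : ℂ) * g Q) (volume.restrict Ω) :=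
    ((Complex.continuous_ofReal.comp_continuousOn
      (hρc.mono subset_closure)).aestronglyMeasurable hΩo.measurableSet).mul hg.1
  have hb : ∀ᵐ Q ∂(volume.restrict Ω), ‖(ρ Q : ℂ) * g Q‖ ≤ ρ₁ * ‖g Q‖ := by
    filter_upwards [ae_restrict_mem hΩo.measurableSet] with Q hQ
    rw [norm_mul, Complex.norm_real]
    exact mul_le_mul_of_nonneg_right (hρ Q hQ) (norm_nonneg _)
  refine ⟨MemLp.of_le_mul hg hm hb, ?_⟩
  rw [normL2_eq_toReal hm, normL2_eq_toReal hg.1]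
  have := ENNReal.toReal_mono (ENNReal.mul_ne_top ENNReal.ofReal_ne_top hg.2.ne)
    (eLpNorm_le_mul_eLpNorm_of_ae_le_mul hb 2)
  rwa [ENNReal.toReal_mul, ENNReal.toReal_ofReal hρ₁] at this

lemma memL2_opL (hΩo : IsOpen Ω) (hΩb : Bornology.IsBounded Ω)
    {A : Fin n → Fin n → E n → ℝ} (hA : ∀ i j, IsC1Closure Ω (A i j)) {ρ : E n → ℝ}
    {f : E n → ℂ} (hf : MemSobolev Ω 2 f)
    (hk : MemL2 Ω fun Q => (ρ Q : ℂ) * kipriyanov P α f Q) : MemL2 Ω (opL Ω P α A ρ f) :=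
  (memLp_finsetSum _ fun j _ => memL2_weakPartial_flux hΩo hΩb hA hf j).neg.add hk

/-- A zero-dimensional space is a single point, whose subsets have empty frontier. -/
lemma dim_pos_of_mem_frontier (hP : P ∈ frontier Ω) : 0 < n := by
  rcases Nat.eq_zero_or_pos n with rfl | h
  · exfalso
    rcases Ω.eq_empty_or_nonempty with rfl | hne
    · simp at hP
    · rw [Subsingleton.eq_univ_of_nonempty hne] at hP
      simp at hP
  · exact h

end fractional

end FracElliptic

/-! ### The theorem on the numerical range -/

theorem lemma2 {n : ℕ} (Ω : Set (FracElliptic.E n)) (P : FracElliptic.E n)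
    (hΩ_open : IsOpen Ω) (hΩ_convex : Convex ℝ Ω) (hΩ_bounded : Bornology.IsBounded Ω)
    (hP : P ∈ frontier Ω)
    (α : ℝ) (hα : α ∈ Set.Ioo (0 : ℝ) 1)
    -- the coefficients of the second order part
    (A : Fin n → Fin n → FracElliptic.E n → ℝ) (hA : ∀ i j, FracElliptic.IsC1Closure Ω (A i j))
    (a : ℝ) (ha : 0 < a)
    (hell : ∀ Q ∈ Ω, ∀ v : Fin n → ℝ, a * ∑ i, v i ^ 2 ≤ ∑ i, ∑ j, A i j Q * v i * v j)
    -- the coefficient of the fractional term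
    (ρ : FracElliptic.E n → ℝ) (μ : ℝ≥0) (hμα : α < μ) (hμ1 : μ ≤ 1)
    (hρ_lip : ∃ M : ℝ≥0, HolderOnWith M μ ρ (closure Ω))
    (ρ₀ ρ₁ : ℝ) (hρ₀ : 0 < ρ₀) (hρ : ∀ Q ∈ Ω, ρ₀ < ρ Q ∧ ρ Q < ρ₁)
    -- the standing accretivity assumption on the fractional term
    (η : ℝ) (hη : η ≠ 0)
    (hacc : ∀ f, FracElliptic.MemH10 Ω f →
      (η ^ 2)⁻¹ * FracElliptic.normL2 Ω f ^ 2 ≤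
        (FracElliptic.innerL2 Ω f (fun Q => (ρ Q : ℂ) * FracElliptic.kipriyanov P α f Q)).re) :
    -- `L` is an operator in `L_2(Ω)`, and the constant `𝒦` exists
    (∀ f ∈ FracElliptic.domL Ω, FracElliptic.MemL2 Ω (FracElliptic.opL Ω P α A ρ f)) ∧
    (∃ 𝒦 : ℝ, 0 < 𝒦 ∧ FracElliptic.IsKipriyanovBound Ω P α 𝒦) ∧
    ∀ 𝒦 : ℝ, 0 < 𝒦 → FracElliptic.IsKipriyanovBound Ω P α 𝒦 →
      ∀ 𝒜 ℐ ξ : ℝ, 𝒜 = FracElliptic.coeffSup Ω A → ℐ = ρ₁ * 𝒦 → ξ = FracElliptic.xi a 𝒜 ℐ η →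
        -- the numerical range is in the sector, for every value of the parameter
        (∀ ε : ℝ, 0 < ε →
          FracElliptic.numericalRange Ω (FracElliptic.domL Ω) (FracElliptic.opL Ω P α A ρ) ⊆
            FracElliptic.sector (FracElliptic.vertex a 𝒜 ℐ η ε : ℂ)
              (FracElliptic.semiAngle a 𝒜 ℐ ε)) ∧
        -- the sign of the vertex
        0 < ξ ∧
        (∀ ε ∈ Set.Ioo 0 ξ, FracElliptic.vertex a 𝒜 ℐ η ε < 0) ∧
        (∀ ε ∈ Set.Ici ξ, 0 ≤ FracElliptic.vertex a 𝒜 ℐ η ε) ∧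
        -- the case of the vertex at zero
        FracElliptic.vertex a 𝒜 ℐ η ξ = 0 ∧
        (∀ ε : ℝ, 0 < ε → FracElliptic.vertex a 𝒜 ℐ η ε = 0 →
          FracElliptic.semiAngle a 𝒜 ℐ ε =
            Real.arctan (Real.sqrt ((𝒜 / (2 * a)) ^ 2 + ℐ ^ 2 * η ^ 2 / (4 * a))
              + 𝒜 / (2 * a))) := by
  have hn : 0 < n := FracElliptic.dim_pos_of_mem_frontier hP
  obtain ⟨Q₀, hQ₀⟩ : Ω.Nonempty := closure_nonempty_iff.1 ⟨P, frontier_subset_closure hP⟩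
  have hρ₁ : 0 < ρ₁ := hρ₀.trans ((hρ Q₀ hQ₀).1.trans (hρ Q₀ hQ₀).2)
  have hρc : ContinuousOn ρ (closure Ω) := by
    obtain ⟨M, hM⟩ := hρ_lip
    exact hM.continuousOn (by exact_mod_cast hα.1.trans hμα)
  have hρb : ∀ Q ∈ Ω, |ρ Q| ≤ ρ₁ := fun Q hQ => by
    rw [abs_of_pos (hρ₀.trans (hρ Q hQ).1)]
    exact (hρ Q hQ).2.le
  obtain ⟨K₀, hK₀, hB₀⟩ := FracElliptic.exists_pos_isKipriyanovBound hn hΩ_open hΩ_convex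
    hΩ_bounded hP hα.1 hα.2
  have hρk : ∀ f, FracElliptic.MemH10 Ω f →
      FracElliptic.MemL2 Ω fun Q => (ρ Q : ℂ) * FracElliptic.kipriyanov P α f Q := fun f hf =>
    ((hB₀ f hf).1.normL2_mul_le hΩ_open hρc hρ₁.le hρb).1
  refine ⟨fun f hf => FracElliptic.memL2_opL hΩ_open hΩ_bounded hA hf.1 (hρk f hf.2),
    ⟨K₀, hK₀, hB₀⟩, fun 𝒦 h𝒦 hB 𝒜 ℐ ξ h𝒜 hℐ hξ => ?_⟩
  have h𝒜0 : 0 ≤ 𝒜 := h𝒜 ▸ FracElliptic.coeffSup_nonneg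
  have hℐ0 : 0 < ℐ := hℐ ▸ mul_pos hρ₁ h𝒦
  have hξ0 : 0 < ξ := hξ ▸ FracElliptic.xi_pos ha hη
  have hv : ∀ {ε : ℝ}, 0 < ε → _ := fun hε => FracElliptic.vertex_eq ha h𝒜0 hℐ0 hη hε
  have hp : ∀ {ε : ℝ}, 0 < ε → _ := fun hε => FracElliptic.vertex_factor_pos ha h𝒜0 hℐ0 hη hε
  refine ⟨fun ε hε => ?_, hξ0, fun ε hε => ?_, fun ε hε => ?_, ?_, fun ε hε h0 => ?_⟩
  · rintro z ⟨f, hf, hf1, rfl⟩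
    have hfL : FracElliptic.MemL2 Ω f := hf.1.memL2
    have hdL := hf.2.memL2_weakPartial hΩ_open
    obtain ⟨hkL, hkb⟩ := hB f hf.2
    obtain ⟨hgL, hgb⟩ := hkL.normL2_mul_le hΩ_open hρc hρ₁.le hρb
    have hacc' := hacc f hf.2
    -- Accretivity concerns `(f, ρ 𝔇^α f)`, the quadratic form `(ρ 𝔇^α f, f)`; they are conjugate
    -- and share the real part.
    rw [FracElliptic.innerL2_conj, Complex.conj_re, hf1, one_pow, mul_one] at hacc'
    have hcs := FracElliptic.norm_innerL2_le hgL hfL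
    rw [hf1, mul_one] at hcs
    have hre := FracElliptic.re_integral_formDensity_ge hΩ_open hΩ_bounded hA hell hdL
    have him := FracElliptic.norm_integral_formDensity_le hΩ_open hΩ_bounded hA hdL
    rw [← h𝒜] at him
    refine FracElliptic.mem_sector (N := FracElliptic.normH10 Ω f) ha h𝒜0 hℐ0 hε
      (Complex.re_add_im _).symm ?_ ?_
    · rw [FracElliptic.innerL2_opL hΩ_open hΩ_bounded hA hf (hρk f hf.2), Complex.add_re]
      exact add_le_add hre hacc'
    · rw [FracElliptic.innerL2_opL hΩ_open hΩ_bounded hA hf (hρk f hf.2), Complex.add_im]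
      refine (abs_add_le _ _).trans (add_le_add ((Complex.abs_im_le_norm _).trans him)
        ((Complex.abs_im_le_norm _).trans (hcs.trans (hgb.trans ?_))))
      rw [hℐ, mul_assoc]
      exact mul_le_mul_of_nonneg_left hkb hρ₁.le
  · rw [hv hε.1, ← hξ]
    exact mul_neg_of_neg_of_pos (sub_neg.2 hε.2) (hp hε.1)
  · have hε0 : 0 < ε := hξ0.trans_le hε
    rw [hv hε0, ← hξ]
    exact mul_nonneg (sub_nonneg.2 hε) (hp hε0).le
  · rw [hv hξ0, ← hξ, sub_self, zero_mul]
  · rw [hv hε, mul_eq_zero, or_iff_left (hp hε).ne', sub_eq_zero] at h0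
    rw [h0]
    exact FracElliptic.semiAngle_xi ha hℐ0
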